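/- **Setting.** All graphs are finite, simple and undirected. Let $\mathcal G$ be a (possibly infinite) family of connected graphs with node sets $V_G$, and let $\pi$ assign to every node $v$ of every $G\in\mathcal G$ a positional encoding $p_v\in\mathbb R^f$ such that distinct nodes, of the same graph or of different graphs of the family, have distinct encodings. A continuous feature transformation $H$ from $c$ to $c'$ channels over $\mathcal G$ assigns to every $G\in\mathcal G$ a continuous map $H_G:(\mathbb R^{c})^{V_G}\to(\mathbb R^{c'})^{V_G}$. Fix a diffusion time $t>0$ and a continuous activation $\sigma:\mathbb R\to\mathbb R$ that is not a polynomial. *BuNN layer of width $d$.* Its parameters are $W\in\mathbb R^{d\times d}$, $b\in\mathbb R^d$ and a 2-layer perceptron $\phi(y)=A_2\,\sigma(A_1y+b_1)+b_2$, $\phi:\mathbb R^{f}\times\mathbb R^{d}\to(\mathbb R^{d})^{d}$, of arbitrary hidden size. For input signals $x_v\in\mathbb R^d$, let $O_v\in O(d)$ be the product of the $d$ Householder matrices $I-2ww^T/\|w\|^2$ (read as $I$ for $w=0$) of the vectors $\phi(p_v,x_v)$; put $h_v=O_v^TWO_vx_v+b$ and $Z=\exp(-t\mathcal L_{\mathcal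 B})h$, where $(\mathcal L_{\mathcal B}X)_u=\frac1{d_u}\sum_{v\sim u}(x_u-O_u^TO_vx_v)$ and $d_u$ is the degree of $u$ ($(\mathcal L_{\mathcal B}X)_u=0$ if $d_u=0$). The output is $\sigma(Z)$, entrywise. *2-layer BuNN of widths $(d,m)$.* It is the composition $D_2\circ\mathrm{layer}_2\circ E_2\circ D_1\circ \mathrm{layer}_1\circ E_1$ of two BuNN layers of width $d$ with linear encoders and decoders $E_1\in\mathbb R^{d\times c}$, $D_1\in\mathbb R^{m\times d}$, $E_2\in\mathbb R^{d\times m}$, $D_2\in\mathbb R^{c'\times d}$, applied at every node separately. **Theorem.** For all $c,c'$ there is a constant $C$, depending only on $c$ and $c'$, such that in the above setting the following hold for every continuous feature transformation $H$ from $c$ to $c'$ channels over $\mathcal G$. 1. 2-layer BuNNs compactly uniformly approximate $H$: for every finite $\mathcal K\subseteq\mathcal G$, every compact $K\subset\mathbb R^c$ and every $\varepsilon>0$ there is a 2-layer BuNN that computes a continuous map $F_G$ on each $G\in\mathcal G$, with $\|F_G(X)-H_G(X)\|_\infty\le\varepsilon$ for all $G\in\mathcal K$ and all $X\in K^{V_G}$.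 The perceptrons $\phi$ of both layers can moreover be chosen to depend on the positional encodings only. 2. Suppose in addition that $\sigma$ is differentiable at some point with non-zero derivative there. Then for every finite $\mathcal K\subseteq\mathcal G$, every compact $K\subset\mathbb R^c$ and every $\varepsilon>0$ there is a 2-layer BuNN as in 1 (its perceptrons $\phi$ now reading both $p_v$ and $x_v$) whose widths satisfy $d,m\le C\sum_{G\in\mathcal K}|V_G|$. -/

import Mathlib

open scoped Matrix

noncomputable section

namespace BundleNN

/-! ### Feature transformations and compact uniform approximation -/

/-- A continuous feature transformation over a family of graphs with node sets `V i`: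
a continuous map `ℝ^{n_i × c} → ℝ^{n_i × c'}` for each member of the family. -/
abbrev FeatureTransformation {ι : Type*} (V : ι → Type*) (c c' : ℕ) :=
  ∀ i, C(V i → Fin c → ℝ, V i → Fin c' → ℝ)

/-- `F` is uniformly `ε`-close to `H` on all members of the finite subfamily `S`, for all node
signals with values in `K`. The norm is the sup norm over all nodes and channels. -/
def IsUniformlyClose {ι : Type*} {V : ι → Type*} [∀ i, Fintype (V i)] {c c' : ℕ}
    (F H : FeatureTransformation V c c') (S : Finset ι) (K : Set (Fin c → ℝ)) (ε : ℝ) : Prop :=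
  ∀ i ∈ S, ∀ X : V i → Fin c → ℝ, (∀ v, X v ∈ K) → ‖F i X - H i X‖ ≤ ε

/-- The set `𝓕` of feature transformations compactly uniformly approximates `H`. -/
def CompactlyUniformlyApproximates {ι : Type*} {V : ι → Type*} [∀ i, Fintype (V i)] {c c' : ℕ}
    (𝓕 : Set (FeatureTransformation V c c')) (H : FeatureTransformation V c c') : Prop :=
  ∀ (S : Finset ι) (K : Set (Fin c → ℝ)), IsCompact K → ∀ ε : ℝ, 0 < ε →
    ∃ F ∈ 𝓕, IsUniformlyClose F H S K ε

/-! ### Flat vector bundles on a graph -/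

section Bundle

variable {V : Type*} [Fintype V] [DecidableEq V] (G : SimpleGraph V) [DecidableRel G.Adj] {d : ℕ}

/-- The bundle adjacency matrix of the flat bundle with node maps `O`: the block at an edge
`(u, v)` is the transport `O_uᵀ O_v`, and the other blocks vanish. -/
def bundleAdjacency (O : V → Matrix (Fin d) (Fin d) ℝ) : Matrix (V × Fin d) (V × Fin d) ℝ :=
  Matrix.of fun p q => if G.Adj p.1 q.1 then ((O p.1)ᵀ * O q.1) p.2 q.2 else 0

/-- The block diagonal degree matrix. -/
def bundleDegree (d : ℕ) : Matrix (V × Fin d) (V × Fin d) ℝ :=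
  Matrix.diagonal fun p => (G.degree p.1 : ℝ)

/-- The random walk normalized bundle Laplacian `D⁻¹ (D - A)`, that is,
`(ℒ X)_u = (1 / d_u) ∑_{v ∼ u} (x_u - O_uᵀ O_v x_v)`. It equals `I - D⁻¹ A` if there are no isolated
nodes; at an isolated node (the one-node graph) the sum is empty and the row is zero. -/
def bundleLaplacian (O : V → Matrix (Fin d) (Fin d) ℝ) : Matrix (V × Fin d) (V × Fin d) ℝ :=
  (Matrix.diagonal fun p => (G.degree p.1 : ℝ)⁻¹) * (bundleDegree G d - bundleAdjacency G O)

/-- The bundle heat kernel `exp (-t ℒ)`. -/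
def bundleHeatKernel (O : V → Matrix (Fin d) (Fin d) ℝ) (t : ℝ) :
    Matrix (V × Fin d) (V × Fin d) ℝ :=
  NormedSpace.exp (-(t • bundleLaplacian G O))

end Bundle

/-! ### Parameterization of the bundle maps -/

/-- The Householder matrix `I - 2 w wᵀ / ‖w‖²`, and the identity for `w = 0`. -/
def householder {d : ℕ} (w : Fin d → ℝ) : Matrix (Fin d) (Fin d) ℝ :=
  1 - (2 / (w ⬝ᵥ w)) • Matrix.vecMulVec w w

/-- The product of the Householder matrices of `d` vectors of `ℝ^d`. -/
def householderProd {d : ℕ} (w : Fin d → Fin d → ℝ) : Matrix (Fin d) (Fin d) ℝ :=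
  (List.ofFn fun k => householder (w k)).prod

/-- The parameters of a two-layer perceptron `ℝ^α → ℝ^β` (one hidden layer). -/
structure TwoLayerMLP (α β : Type) where
  hidden : ℕ
  A₁ : Matrix (Fin hidden) α ℝ
  b₁ : Fin hidden → ℝ
  A₂ : Matrix β (Fin hidden) ℝ
  b₂ : β → ℝ

/-- `x ↦ A₂ σ(A₁ x + b₁) + b₂`, with `σ` acting entrywise. -/
def TwoLayerMLP.eval {α β : Type} [Fintype α] (φ : TwoLayerMLP α β) (σ : ℝ → ℝ)
    (x : α → ℝ) : β → ℝ :=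
  φ.A₂ *ᵥ (fun r => σ ((φ.A₁ *ᵥ x) r + φ.b₁ r)) + φ.b₂

/-! ### Bundle neural networks -/

/-- The parameters of a BuNN layer on `d`-dimensional signals, with `f`-dimensional positional
encodings. The perceptron `φ` reads the positional encoding and the signal of a node, and
returns the `d` Householder vectors of the bundle map at that node. -/
structure Layer (f d : ℕ) where
  φ : TwoLayerMLP (Fin f ⊕ Fin d) (Fin d × Fin d)
  W : Matrix (Fin d) (Fin d) ℝ
  b : Fin d → ℝ

namespace Layer

variable {f d : ℕ} (L : Layer f d) (σ : ℝ → ℝ)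

/-- The perceptron of the layer ignores the node signal: the bundle maps are functions of the
positional encodings alone. -/
def IsPositional : Prop := ∀ r j, L.φ.A₁ r (Sum.inr j) = 0

/-- The orthogonal bundle map at a node with positional encoding `p` and signal `x`. -/
def bundleMap (p : Fin f → ℝ) (x : Fin d → ℝ) : Matrix (Fin d) (Fin d) ℝ :=
  householderProd fun k j => L.φ.eval σ (Sum.elim p x) (k, j)

variable {V : Type*} [Fintype V] [DecidableEq V] (G : SimpleGraph V) [DecidableRel G.Adj]

/-- The update step `h_v = O_vᵀ W O_v x_v + b`. -/
def update (P : V → Fin f → ℝ) (X : V → Fin d → ℝ) (v : V) : Fin d → ℝ :=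
  ((L.bundleMap σ (P v) (X v))ᵀ * L.W * L.bundleMap σ (P v) (X v)) *ᵥ X v + L.b

/-- The diffusion step `Z = ℋ(t) H` over the learned bundle. -/
def diffuse (t : ℝ) (P : V → Fin f → ℝ) (X : V → Fin d → ℝ) (v : V) (j : Fin d) : ℝ :=
  (bundleHeatKernel G (fun u => L.bundleMap σ (P u) (X u)) t *ᵥ
    fun q : V × Fin d => L.update σ P X q.1 q.2) (v, j)

/-- The output `σ(Z)` of the layer. -/
def eval (t : ℝ) (P : V → Fin f → ℝ) (X : V → Fin d → ℝ) : V → Fin d → ℝ :=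
  fun v j => σ (L.diffuse σ G t P X v j)

end Layer

/-- The parameters of a two-layer deep BuNN from `c` to `c'` channels, with `f`-dimensional
positional encodings and a linear encoder and decoder at each layer. Both layers act on
`d`-dimensional signals; the signal between the two layers is `m`-dimensional. -/
structure BuNN₂ (f c c' d m : ℕ) where
  enc₁ : Matrix (Fin d) (Fin c) ℝ
  layer₁ : Layer f d
  dec₁ : Matrix (Fin m) (Fin d) ℝ
  enc₂ : Matrix (Fin d) (Fin m) ℝ
  layer₂ : Layer f d
  dec₂ : Matrix (Fin c') (Fin d) ℝ

namespace BuNN₂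

variable {f c c' d m : ℕ}

/-- The map on node signals given by a two-layer deep BuNN with activation `σ` and diffusion
time `t`; encoders and decoders act at every node separately. -/
def eval (B : BuNN₂ f c c' d m) (σ : ℝ → ℝ) {V : Type*} [Fintype V] [DecidableEq V]
    (G : SimpleGraph V) [DecidableRel G.Adj] (t : ℝ) (P : V → Fin f → ℝ)
    (X : V → Fin c → ℝ) : V → Fin c' → ℝ :=
  let Y : V → Fin m → ℝ := fun v =>
    B.dec₁ *ᵥ B.layer₁.eval σ G t P (fun u => B.enc₁ *ᵥ X u) v
  fun v => B.dec₂ *ᵥ B.layer₂.eval σ G t P (fun u => B.enc₂ *ᵥ Y u) v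

/-- The bundle maps of both layers are functions of the positional encodings alone. -/
def IsPositional (B : BuNN₂ f c c' d m) : Prop :=
  B.layer₁.IsPositional ∧ B.layer₂.IsPositional

/-- The feature transformation `F` is the one computed by `B` on every graph of the family. -/
def Computes {ι : Type*} {V : ι → Type*} [∀ i, Fintype (V i)] [∀ i, DecidableEq (V i)]
    (B : BuNN₂ f c c' d m) (σ : ℝ → ℝ) (G : ∀ i, SimpleGraph (V i))
    [∀ i, DecidableRel (G i).Adj] (t : ℝ) (P : ∀ i, V i → Fin f → ℝ)
    (F : FeatureTransformation V c c') : Prop :=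
  ∀ i X, F i X = B.eval σ (G i) t (P i) X

end BuNN₂

/-- The continuous feature transformations that are computed by two-layer deep BuNNs whose layers
have width `d`, with an `m`-dimensional signal between the layers. -/
def bunnClass {ι : Type*} {V : ι → Type*} [∀ i, Fintype (V i)] [∀ i, DecidableEq (V i)]
    (σ : ℝ → ℝ) (G : ∀ i, SimpleGraph (V i)) [∀ i, DecidableRel (G i).Adj] (t : ℝ) {f : ℕ}
    (P : ∀ i, V i → Fin f → ℝ) (c c' d m : ℕ) : Set (FeatureTransformation V c c') :=
  {F | ∃ B : BuNN₂ f c c' d m, B.Computes σ G t P F}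

/-- The feature transformations that are computed by two-layer deep BuNNs, of any width, whose
bundle maps are functions of the positional encodings alone. -/
def positionalBunnClass {ι : Type*} {V : ι → Type*} [∀ i, Fintype (V i)]
    [∀ i, DecidableEq (V i)]
    (σ : ℝ → ℝ) (G : ∀ i, SimpleGraph (V i)) [∀ i, DecidableRel (G i).Adj] (t : ℝ) {f : ℕ}
    (P : ∀ i, V i → Fin f → ℝ) (c c' : ℕ) : Set (FeatureTransformation V c c') :=
  {F | ∃ (d m : ℕ) (B : BuNN₂ f c c' d m), B.IsPositional ∧ B.Computes σ G t P F}

/-- Positional encodings are injective on the family: distinct nodes, of the same or of different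
members of the family, have distinct encodings. -/
def InjectiveEncoding {ι : Type*} {V : ι → Type*} {f : ℕ} (P : ∀ i, V i → Fin f → ℝ) : Prop :=
  Function.Injective fun x : Σ i, V i => P x.1 x.2

end BundleNN

end

/-!
If the bundle maps are orthogonal, the bundle heat kernel is the scalar heat kernel `κ` of the graph
twisted by the transports (`bundleHeatKernel_apply`). Hence a layer maps `x` to
`σ(O_vᵀ ∑ᵤ κ(v, u) (W Oᵤ xᵤ + Oᵤ b))`, and in a channel that no reflection vector touches the
transports disappear (`diffuse_apply_of_fixed`). The kernel `κ` is a stochastic matrix, it is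
invertible as an exponential, and its entries are positive since the graph is connected.

Encodings are injective, so a perceptron can take prescribed values at finitely many nodes. Flipping
the sign of a copy of a channel at one node only isolates the signal of that node. This gives
positional layers that compute `σ(∑ᵤ κ(v, u) ⟨A u, xᵤ⟩ + b)` for arbitrary node dependent weights
`A` (`exists_gather_layer`). In both parts the first layer makes the signals of all nodes available
at every node, up to a network in one variable that approximates the identity, along with a constant
channel (`exists_broadcast_layer`).

With positional maps only, the second layer collects, at each node, features that depend
continuously and injectively on the node and the signal (`collect_broadcast_injective`). The
activation of the layer followed by the decoder is then a perceptron in these features.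

For narrow networks the second layer reflects a constant channel along `(1, s)`, where `s` is a
network in the encoding and the whole signal (`exists_rotation_layer`). A reflection produces any
value in a bounded interval, so every node computes its entry of `κ⁻¹ H`, which the diffusion turns
into `H`. A difference quotient of `σ`, which takes two channels, plays the role of
the approximate identity, and this bounds the width.

Both parts rest on the density of perceptrons with a non-polynomial activation
(`exists_neuronSpan_approx`): differentiating mollified ridge functions shows that the closed span
contains the powers of every functional `ℓ`, hence `exp ℓ`, and the exponentials span an algebra
that separates points.
-/

namespace BundleNN

/-! ### The heat kernel of a graph -/

theorem pow_apply_nonneg {V : Type*} [Fintype V] [DecidableEq V] {A : Matrix V V ℝ}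
    (hA : ∀ u v, 0 ≤ A u v) (n : ℕ) (u v : V) : 0 ≤ (A ^ n) u v := by
  induction n generalizing u v with
  | zero => rw [pow_zero, Matrix.one_apply]; split_ifs <;> norm_num
  | succ n ih =>
    rw [pow_succ, Matrix.mul_apply]
    exact Finset.sum_nonneg fun w _ => mul_nonneg (ih _ _) (hA _ _)

/-- An entrywise nonnegative matrix that is positive along the edges of a graph has positive
powers between the ends of its walks. -/
theorem pow_length_apply_pos {V : Type*} [Fintype V] [DecidableEq V] {G : SimpleGraph V}
    {A : Matrix V V ℝ} (hA : ∀ u v, 0 ≤ A u v) (hadj : ∀ u v, G.Adj u v → 0 < A u v) {u v : V}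
    (p : G.Walk u v) : 0 < (A ^ p.length) u v := by
  induction p with
  | nil => simp
  | cons h p ih =>
    rw [SimpleGraph.Walk.length_cons, pow_succ', Matrix.mul_apply]
    exact Finset.sum_pos' (fun w _ => mul_nonneg (hA _ _) (pow_apply_nonneg hA _ _ _))
      ⟨_, Finset.mem_univ _, mul_pos (hadj _ _ h) ih⟩

theorem hasSum_exp_apply {V : Type*} [Fintype V] [DecidableEq V] (A : Matrix V V ℝ) (u v : V) :
    HasSum (fun n : ℕ => ((n.factorial : ℝ)⁻¹) * (A ^ n) u v) (NormedSpace.exp A u v) := by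
  have h := open scoped Matrix.Norms.Operator in NormedSpace.exp_series_hasSum_exp' (𝕂 := ℝ) A
  have h2 : HasSum (fun n : ℕ => ((n.factorial : ℝ)⁻¹) * (A ^ n) u v) (NormedSpace.exp A u v) :=
    Pi.hasSum.1 (Pi.hasSum.1 h u) v
  exact h2

theorem exp_apply_pos_of_connected {V : Type*} [Fintype V] [DecidableEq V] {G : SimpleGraph V}
    (hG : G.Connected) {A : Matrix V V ℝ} (hA : ∀ u v, 0 ≤ A u v)
    (hadj : ∀ u v, G.Adj u v → 0 < A u v) (u v : V) : 0 < NormedSpace.exp A u v := by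
  obtain ⟨p⟩ := hG.preconnected u v
  have h := le_hasSum (hasSum_exp_apply A u v) p.length
    (fun n _ => mul_nonneg (by positivity) (pow_apply_nonneg hA n u v))
  exact lt_of_lt_of_le (mul_pos (by positivity) (pow_length_apply_pos hA hadj p)) h

section Heat

variable {V : Type*} [Fintype V] [DecidableEq V] (G : SimpleGraph V) [DecidableRel G.Adj]

/-- The random walk normalized Laplacian `D⁻¹ (D - A)` of a graph; its row at an isolated node is
zero. -/
noncomputable def nodeLaplacian : Matrix V V ℝ :=
  Matrix.diagonal (fun v => (G.degree v : ℝ)⁻¹) *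
    (Matrix.diagonal (fun v => (G.degree v : ℝ)) - G.adjMatrix ℝ)

/-- The scalar heat kernel `exp (-t ℒ)` of a graph. -/
noncomputable def heat (t : ℝ) : Matrix V V ℝ := NormedSpace.exp (-(t • nodeLaplacian G))

theorem nodeLaplacian_apply (u v : V) : nodeLaplacian G u v =
    (G.degree u : ℝ)⁻¹ * ((if u = v then (G.degree u : ℝ) else 0) - if G.Adj u v then 1 else 0) := by
  simp [nodeLaplacian, Matrix.diagonal_mul, Matrix.diagonal_apply, SimpleGraph.adjMatrix_apply]

theorem nodeLaplacian_mul_ones : nodeLaplacian G * Matrix.of (fun _ _ : V => (1 : ℝ)) = 0 := by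
  ext u v
  simp [Matrix.mul_apply, nodeLaplacian_apply, ← Finset.mul_sum, Finset.sum_sub_distrib,
    ← SimpleGraph.card_neighborFinset_eq_degree, SimpleGraph.neighborFinset_eq_filter]

theorem heat_sum (t : ℝ) (u : V) : ∑ v, heat G t u v = 1 := by
  have h : SemiconjBy (Matrix.of (fun _ _ : V => (1 : ℝ))) 0 (-(t • nodeLaplacian G)) := by
    simp [SemiconjBy, nodeLaplacian_mul_ones]
  have h2 : Matrix.of (fun _ _ : V => (1 : ℝ)) * NormedSpace.exp 0 =
      NormedSpace.exp (-(t • nodeLaplacian G)) * Matrix.of (fun _ _ : V => (1 : ℝ)) :=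
    open scoped Matrix.Norms.Operator in h.exp_right.eq
  have h3 := congrFun (congrFun h2 u) u
  rw [NormedSpace.exp_zero, mul_one] at h3
  simpa [Matrix.mul_apply, heat] using h3.symm

theorem isUnit_heat (t : ℝ) : IsUnit (heat G t) := Matrix.isUnit_exp _

theorem heat_row_injective (t : ℝ) : Function.Injective (heat G t) := by
  intro u v h
  by_contra huv
  have hd := (Matrix.isUnit_iff_isUnit_det _).1 (isUnit_heat G t)
  rw [Matrix.det_zero_of_row_eq huv h] at hd
  simp at hd

theorem heat_pos (hG : G.Connected) {t : ℝ} (ht : 0 < t) (u v : V) : 0 < heat G t u v := by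
  -- `exp (-t ℒ) = e⁻ᵗ exp (t (1 - ℒ))`, and `1 - ℒ` is entrywise nonnegative.
  have hsplit : -(t • nodeLaplacian G) =
      (-t) • (1 : Matrix V V ℝ) + t • (1 - nodeLaplacian G) := by
    rw [smul_sub]; module
  have hcomm : Commute ((-t) • (1 : Matrix V V ℝ)) (t • (1 - nodeLaplacian G)) :=
    (Commute.one_left _).smul_left _
  have hexp : NormedSpace.exp ((-t) • (1 : Matrix V V ℝ)) = Real.exp (-t) • 1 := by
    rw [Matrix.smul_one_eq_diagonal, Matrix.exp_diagonal, Matrix.smul_one_eq_diagonal]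
    congr 1
    ext v
    rw [Pi.coe_exp, Real.exp_eq_exp_ℝ]
  rw [heat, hsplit, Matrix.exp_add_of_commute _ _ hcomm, hexp, smul_mul_assoc, one_mul,
    Matrix.smul_apply, smul_eq_mul]
  refine mul_pos (Real.exp_pos _) (exp_apply_pos_of_connected hG ?_ ?_ u v)
  · intro u v
    rw [Matrix.smul_apply, smul_eq_mul, Matrix.sub_apply, nodeLaplacian_apply, Matrix.one_apply]
    refine mul_nonneg ht.le ?_
    have h0 : (0 : ℝ) ≤ (G.degree u : ℝ)⁻¹ := by positivity
    by_cases huv : u = v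
    · subst huv
      rcases eq_or_ne (G.degree u : ℝ) 0 with h | h <;> simp [h]
    · by_cases ha : G.Adj u v <;> simp [huv, ha]
  · intro u v h
    have hd : 0 < G.degree u := (G.degree_pos_iff_exists_adj u).2 ⟨v, h⟩
    rw [Matrix.smul_apply, smul_eq_mul, Matrix.sub_apply, nodeLaplacian_apply, Matrix.one_apply]
    simp only [h.ne, h, if_false, if_true]
    have : (0 : ℝ) < (G.degree u : ℝ)⁻¹ := by positivity
    exact mul_pos ht (by linarith)

end Heat

/-! ### The heat kernel of a flat bundle -/

section FlatBundle

variable {V : Type*} [Fintype V] [DecidableEq V] (G : SimpleGraph V) [DecidableRel G.Adj] {d : ℕ}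

/-- For orthogonal `O`, the map `A ↦ (A u v • O_uᵀ O_v)_{u, v}` from matrices indexed by nodes to
matrices over the bundle is a ring homomorphism. -/
def flatLift (O : V → Matrix (Fin d) (Fin d) ℝ) (h₁ : ∀ v, (O v)ᵀ * O v = 1)
    (h₂ : ∀ v, O v * (O v)ᵀ = 1) : Matrix V V ℝ →+* Matrix (V × Fin d) (V × Fin d) ℝ where
  toFun A := Matrix.of fun p q => A p.1 q.1 * ((O p.1)ᵀ * O q.1) p.2 q.2
  map_one' := by
    ext ⟨u, i⟩ ⟨v, j⟩
    rcases eq_or_ne u v with rfl | h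
    · simp [h₁, Matrix.one_apply]
    · simp [h, Matrix.one_apply]
  map_zero' := by ext; simp
  map_add' A B := by ext; simp [add_mul]
  map_mul' A B := by
    ext ⟨u, i⟩ ⟨w, j⟩
    rw [Matrix.mul_apply, Fintype.sum_prod_type, Matrix.of_apply, Matrix.mul_apply, Finset.sum_mul]
    refine Finset.sum_congr rfl fun v _ => ?_
    have : (O u)ᵀ * O w = ((O u)ᵀ * O v) * ((O v)ᵀ * O w) := by
      rw [Matrix.mul_assoc, ← Matrix.mul_assoc (O v), h₂, Matrix.one_mul]
    simp only [Matrix.of_apply]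
    rw [this, Matrix.mul_apply, Finset.mul_sum]
    refine Finset.sum_congr rfl fun k _ => ?_
    ring

/-- The heat kernel of a flat bundle is the scalar heat kernel twisted by the transports. -/
theorem bundleHeatKernel_apply (O : V → Matrix (Fin d) (Fin d) ℝ) (h₁ : ∀ v, (O v)ᵀ * O v = 1)
    (h₂ : ∀ v, O v * (O v)ᵀ = 1) (t : ℝ) (p q : V × Fin d) :
    bundleHeatKernel G O t p q = heat G t p.1 q.1 * ((O p.1)ᵀ * O q.1) p.2 q.2 := by
  have hL : -(t • bundleLaplacian G O) = flatLift O h₁ h₂ (-(t • nodeLaplacian G)) := by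
    ext ⟨u, i⟩ ⟨v, j⟩
    simp only [bundleLaplacian, bundleDegree, bundleAdjacency, flatLift, Matrix.neg_apply,
      Matrix.smul_apply, Matrix.diagonal_mul, Matrix.sub_apply, Matrix.of_apply, RingHom.coe_mk,
      MonoidHom.coe_mk, OneHom.coe_mk, nodeLaplacian_apply, Matrix.diagonal_apply, smul_eq_mul,
      Prod.mk.injEq]
    rcases eq_or_ne u v with rfl | h
    · simp only [h₁, Matrix.one_apply, SimpleGraph.irrefl, if_true, true_and, if_false, sub_zero]
      split_ifs <;> ring
    · by_cases ha : G.Adj u v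
      · simp only [h, ha, if_true, if_false, false_and]
        ring
      · simp [h, ha]
  have hc : Continuous (flatLift O h₁ h₂) := by
    refine continuous_matrix fun p q => ?_
    change Continuous fun A : Matrix V V ℝ => A p.1 q.1 * ((O p.1)ᵀ * O q.1) p.2 q.2
    fun_prop
  have h : flatLift O h₁ h₂ (NormedSpace.exp (-(t • nodeLaplacian G))) =
      NormedSpace.exp (flatLift O h₁ h₂ (-(t • nodeLaplacian G))) :=
    open scoped Matrix.Norms.Operator in
    NormedSpace.map_exp (flatLift O h₁ h₂) hc (-(t • nodeLaplacian G))
  rw [bundleHeatKernel, hL, ← h]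
  rfl

end FlatBundle

/-! ### Products of Householder matrices -/

section Householder

variable {d : ℕ}

theorem householder_transpose (w : Fin d → ℝ) : (householder w)ᵀ = householder w := by
  simp [householder, Matrix.transpose_sub, Matrix.transpose_smul, Matrix.transpose_vecMulVec]

theorem householder_mulVec (w x : Fin d → ℝ) :
    householder w *ᵥ x = x - (2 * (w ⬝ᵥ x) / (w ⬝ᵥ w)) • w := by
  rw [householder, Matrix.sub_mulVec, Matrix.one_mulVec, Matrix.smul_mulVec,
    Matrix.vecMulVec_mulVec]
  ext i
  simp
  ring

theorem householder_mul_self (w : Fin d → ℝ) : householder w * householder w = 1 := by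
  refine Matrix.ext_of_mulVec_single fun j => ?_
  rw [← Matrix.mulVec_mulVec, Matrix.one_mulVec]
  generalize (Pi.single j 1 : Fin d → ℝ) = x
  rw [householder_mulVec, householder_mulVec]
  rcases eq_or_ne (w ⬝ᵥ w) 0 with h | h
  · simp [h]
  · ext i
    simp only [dotProduct_sub, dotProduct_smul, Pi.sub_apply, Pi.smul_apply, smul_eq_mul]
    field_simp
    ring

theorem householderProd_mul_transpose (w : Fin d → Fin d → ℝ) :
    householderProd w * (householderProd w)ᵀ = 1 := by
  rw [householderProd]
  suffices ∀ l : List (Matrix (Fin d) (Fin d) ℝ), (∀ A ∈ l, A * Aᵀ = 1) →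
      l.prod * l.prodᵀ = 1 by
    refine this _ fun A hA => ?_
    obtain ⟨k, rfl⟩ := (List.mem_ofFn' _ _).1 hA
    rw [householder_transpose, householder_mul_self]
  intro l hl
  induction l with
  | nil => simp
  | cons A l ih =>
    rw [List.prod_cons, Matrix.transpose_mul, Matrix.mul_assoc, ← Matrix.mul_assoc l.prod,
      ih fun B hB => hl B (List.mem_cons_of_mem _ hB), Matrix.one_mul, hl A List.mem_cons_self]

theorem householderProd_transpose_mul (w : Fin d → Fin d → ℝ) :
    (householderProd w)ᵀ * householderProd w = 1 :=
  mul_eq_one_comm.1 (householderProd_mul_transpose w)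

/-- A channel in which all the vectors vanish is fixed by the product. -/
theorem householderProd_mulVec_of_eq_zero (w : Fin d → Fin d → ℝ) {r : Fin d}
    (h : ∀ k, w k r = 0) (x : Fin d → ℝ) : (householderProd w *ᵥ x) r = x r := by
  rw [householderProd]
  suffices ∀ l : List (Matrix (Fin d) (Fin d) ℝ), (∀ A ∈ l, ∀ x, (A *ᵥ x) r = x r) →
      ∀ x, (l.prod *ᵥ x) r = x r by
    refine this _ (fun A hA x => ?_) x
    obtain ⟨k, rfl⟩ := (List.mem_ofFn' _ _).1 hA
    simp [householder_mulVec, h]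
  intro l hl
  induction l with
  | nil => simp
  | cons A l ih =>
    intro x
    rw [List.prod_cons, ← Matrix.mulVec_mulVec, hl A List.mem_cons_self,
      ih fun B hB => hl B (List.mem_cons_of_mem _ hB)]

theorem householderProd_transpose_mulVec_of_eq_zero (w : Fin d → Fin d → ℝ) {r : Fin d}
    (h : ∀ k, w k r = 0) (x : Fin d → ℝ) : ((householderProd w)ᵀ *ᵥ x) r = x r := by
  conv_rhs => rw [← Matrix.one_mulVec x, ← householderProd_mul_transpose w,
    ← Matrix.mulVec_mulVec, householderProd_mulVec_of_eq_zero w h]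

/-- Reflections along pairwise orthogonal vectors act independently of each other. -/
theorem householderProd_mulVec_of_orthogonal (w : Fin d → Fin d → ℝ)
    (h : Pairwise fun k l => w k ⬝ᵥ w l = 0) (x : Fin d → ℝ) :
    householderProd w *ᵥ x = x - ∑ k, (2 * (w k ⬝ᵥ x) / (w k ⬝ᵥ w k)) • w k := by
  have key : ∀ l : List (Fin d), l.Nodup → (l.map fun k => householder (w k)).prod *ᵥ x =
      x - (l.map fun k => (2 * (w k ⬝ᵥ x) / (w k ⬝ᵥ w k)) • w k).sum := by
    intro l
    induction l with
    | nil => simp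
    | cons k l ih =>
      intro hl
      rw [List.nodup_cons] at hl
      rw [List.map_cons, List.prod_cons, ← Matrix.mulVec_mulVec, ih hl.2, householder_mulVec]
      have h0 : w k ⬝ᵥ (l.map fun k => (2 * (w k ⬝ᵥ x) / (w k ⬝ᵥ w k)) • w k).sum = 0 := by
        have : ∀ l' : List (Fin d), k ∉ l' →
            w k ⬝ᵥ (l'.map fun k => (2 * (w k ⬝ᵥ x) / (w k ⬝ᵥ w k)) • w k).sum = 0 := by
          intro l'
          induction l' with
          | nil => simp
          | cons j l' ih' =>
            intro hj
            simp only [List.mem_cons, not_or] at hj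
            rw [List.map_cons, List.sum_cons, dotProduct_add, ih' hj.2, dotProduct_smul, h hj.1]
            simp
        exact this l hl.1
      rw [dotProduct_sub, h0, List.map_cons, List.sum_cons, sub_zero]
      abel
  rw [householderProd, List.ofFn_eq_map, key _ (List.nodup_finRange d),
    ← List.ofFn_eq_map, List.sum_ofFn]

end Householder

/-! ### One layer -/

section Diffusion

variable {V : Type*} [Fintype V] [DecidableEq V] (G : SimpleGraph V) [DecidableRel G.Adj]
  {f d : ℕ} (L : Layer f d) (σ : ℝ → ℝ) (t : ℝ) (P : V → Fin f → ℝ) (X : V → Fin d → ℝ)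

/-- In the frame given by the bundle maps, diffusion is the scalar heat kernel. -/
theorem diffuse_eq (v : V) : L.diffuse σ G t P X v = (L.bundleMap σ (P v) (X v))ᵀ *ᵥ
    ∑ u, heat G t v u • (L.W *ᵥ (L.bundleMap σ (P u) (X u) *ᵥ X u) +
      L.bundleMap σ (P u) (X u) *ᵥ L.b) := by
  have hO : ∀ u, L.bundleMap σ (P u) (X u) * (L.bundleMap σ (P u) (X u))ᵀ = 1 :=
    fun u => householderProd_mul_transpose _
  have hO' : ∀ u, (L.bundleMap σ (P u) (X u))ᵀ * L.bundleMap σ (P u) (X u) = 1 :=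
    fun u => householderProd_transpose_mul _
  have hupd : ∀ u, L.W *ᵥ (L.bundleMap σ (P u) (X u) *ᵥ X u) + L.bundleMap σ (P u) (X u) *ᵥ L.b =
      L.bundleMap σ (P u) (X u) *ᵥ L.update σ P X u := by
    intro u
    simp only [Layer.update, Matrix.mulVec_add, Matrix.mulVec_mulVec]
    congr 2
    rw [← Matrix.mul_assoc, ← Matrix.mul_assoc, hO, Matrix.one_mul]
  simp_rw [hupd]
  ext j
  rw [Layer.diffuse, Matrix.mulVec, dotProduct, Fintype.sum_prod_type, Matrix.mulVec_sum,
    Finset.sum_apply]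
  refine Finset.sum_congr rfl fun u _ => ?_
  simp only [bundleHeatKernel_apply G (fun u => L.bundleMap σ (P u) (X u)) hO' hO]
  rw [Matrix.mulVec_smul, Matrix.mulVec_mulVec, Pi.smul_apply, smul_eq_mul, Matrix.mulVec,
    dotProduct, Finset.mul_sum]
  exact Finset.sum_congr rfl fun k _ => by ring

/-- In a channel that the bundle maps fix, a layer averages its update with the weights of the
scalar heat kernel. -/
theorem diffuse_apply_of_fixed {r : Fin d}
    (h : ∀ u k, L.φ.eval σ (Sum.elim (P u) (X u)) (k, r) = 0) (v : V) :
    L.diffuse σ G t P X v r =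
      ∑ u, heat G t v u * (L.W *ᵥ (L.bundleMap σ (P u) (X u) *ᵥ X u)) r + L.b r := by
  rw [diffuse_eq, Layer.bundleMap, householderProd_transpose_mulVec_of_eq_zero _ (h v),
    Finset.sum_apply]
  simp only [Pi.smul_apply, Pi.add_apply, smul_eq_mul, mul_add, Finset.sum_add_distrib]
  congr 1
  have : ∀ u, (L.bundleMap σ (P u) (X u) *ᵥ L.b) r = L.b r :=
    fun u => householderProd_mulVec_of_eq_zero _ (h u) _
  simp_rw [this]
  rw [← Finset.sum_mul, heat_sum, one_mul]

theorem continuous_layer_eval (hσ : Continuous σ)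
    (h : ∀ p, Continuous fun x => L.bundleMap σ p x) :
    Continuous fun X : V → Fin d → ℝ => L.eval σ G t P X := by
  have hu : ∀ u, Continuous fun X : V → Fin d → ℝ => L.bundleMap σ (P u) (X u) :=
    fun u => (h (P u)).comp (continuous_apply u)
  refine continuous_pi fun v => continuous_pi fun j => hσ.comp ?_
  refine (continuous_apply j).comp (?_ : Continuous fun X : V → Fin d → ℝ =>
    L.diffuse σ G t P X v)
  simp_rw [diffuse_eq]
  have hX : ∀ u, Continuous fun X : V → Fin d → ℝ => X u := fun u => continuous_apply u
  refine (hu v).matrix_transpose.matrix_mulVec ?_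
  refine continuous_finsetSum _ fun u _ => ?_
  refine Continuous.fun_const_smul ?_ _
  exact (continuous_const.matrix_mulVec ((hu u).matrix_mulVec (hX u))).add
    ((hu u).matrix_mulVec continuous_const)

theorem continuous_bunn_eval {c c' m : ℕ} (B : BuNN₂ f c c' d m) (hσ : Continuous σ)
    (h₁ : ∀ p, Continuous fun x => B.layer₁.bundleMap σ p x)
    (h₂ : ∀ p, Continuous fun x => B.layer₂.bundleMap σ p x) :
    Continuous fun X : V → Fin c → ℝ => B.eval σ G t P X := by
  have e₁ : Continuous fun X : V → Fin c → ℝ => fun u => B.enc₁ *ᵥ X u :=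
    continuous_pi fun u => continuous_const.matrix_mulVec (continuous_apply u)
  have d₁ := (continuous_layer_eval G B.layer₁ σ t P hσ h₁).comp e₁
  have e₂ : Continuous fun Z : V → Fin d → ℝ => fun u => B.enc₂ *ᵥ (B.dec₁ *ᵥ Z u) :=
    continuous_pi fun u => continuous_const.matrix_mulVec
      (continuous_const.matrix_mulVec (continuous_apply u))
  have d₂ := ((continuous_layer_eval G B.layer₂ σ t P hσ h₂).comp e₂).comp d₁
  exact continuous_pi fun v => continuous_const.matrix_mulVec ((continuous_apply v).comp d₂)

theorem continuous_bundleMap_of_isPositional (h : L.IsPositional) (p : Fin f → ℝ) :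
    Continuous fun x => L.bundleMap σ p x := by
  have : ∀ x, L.bundleMap σ p x = L.bundleMap σ p 0 := by
    intro x
    simp only [Layer.bundleMap, TwoLayerMLP.eval, Matrix.mulVec, dotProduct, Fintype.sum_sum_type,
      Sum.elim_inl, Sum.elim_inr, h _ _, zero_mul]
  simp_rw [this]
  exact continuous_const

end Diffusion

/-! ### Density of single-hidden-layer networks -/

section Density

open Filter Topology MeasureTheory

/-- A smooth function whose `k`-th derivative vanishes is a polynomial of degree less than `k`. -/
theorem exists_coeff_of_iteratedDeriv_eq_zero (k : ℕ) {f : ℝ → ℝ} (hf : ContDiff ℝ (⊤ : ℕ∞) f)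
    (h : ∀ x, iteratedDeriv k f x = 0) :
    ∃ c : ℕ → ℝ, ∀ x, f x = ∑ i ∈ Finset.range k, c i * x ^ i := by
  induction k generalizing f with
  | zero => exact ⟨0, by simpa using h⟩
  | succ k ih =>
    have hd : ContDiff ℝ (⊤ : ℕ∞) (deriv f) := (contDiff_infty_iff_deriv.1 hf).2
    obtain ⟨c, hc⟩ := ih hd fun x => by rw [← iteratedDeriv_succ', h x]
    have hp : ∀ x, HasDerivAt (fun x => ∑ i ∈ Finset.range k, c i / (i + 1) * x ^ (i + 1))
        (∑ i ∈ Finset.range k, c i * x ^ i) x := by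
      intro x
      refine HasDerivAt.fun_sum fun i _ => ?_
      convert! (hasDerivAt_pow (i + 1) x).const_mul (c i / (i + 1)) using 1
      have : (i : ℝ) + 1 ≠ 0 := by positivity
      rw [Nat.add_sub_cancel]
      push_cast
      field_simp
    have hfd : Differentiable ℝ f := hf.differentiable (by simp)
    have hconst := is_const_of_deriv_eq_zero
      (f := fun x => f x - ∑ i ∈ Finset.range k, c i / (i + 1) * x ^ (i + 1))
      (fun x => (hfd x).sub (hp x).differentiableAt) (fun x => by
        have := ((hfd x).hasDerivAt.sub (hp x)).deriv
        rw [hc x, sub_self] at this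
        exact this)
    refine ⟨fun i => if i = 0 then f 0 else c (i - 1) / i, fun x => ?_⟩
    rw [Finset.sum_range_succ']
    have := hconst x 0
    simp at this ⊢
    linarith

/-- Pointwise limits of polynomial functions of bounded degree are polynomial. -/
theorem exists_polynomial_of_tendsto (k : ℕ) {F : ℕ → ℝ → ℝ} {f : ℝ → ℝ}
    (hF : ∀ n, ∃ c : ℕ → ℝ, ∀ x, F n x = ∑ i ∈ Finset.range k, c i * x ^ i)
    (hlim : ∀ x, Tendsto (fun n => F n x) atTop (𝓝 (f x))) :
    ∃ p : Polynomial ℝ, ∀ x, f x = p.eval x := by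
  let S : Submodule ℝ (ℝ → ℝ) :=
    Submodule.span ℝ (Set.range fun i : Fin k => fun x : ℝ => x ^ (i : ℕ))
  have : FiniteDimensional ℝ S := FiniteDimensional.span_of_finite ℝ (Set.finite_range _)
  have hS : IsClosed (S : Set (ℝ → ℝ)) := S.closed_of_finiteDimensional
  have hmem : f ∈ S := by
    refine hS.mem_of_tendsto (tendsto_pi_nhds.2 hlim) (Eventually.of_forall fun n => ?_)
    obtain ⟨c, hc⟩ := hF n
    have : F n = ∑ i : Fin k, c i • fun x : ℝ => x ^ (i : ℕ) := by
      ext x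
      rw [hc x, Finset.sum_apply, Finset.sum_range]
      rfl
    rw [this]
    exact S.sum_mem fun i _ => S.smul_mem _ (Submodule.subset_span ⟨i, rfl⟩)
  have hpoly : ∀ g ∈ S, ∃ p : Polynomial ℝ, ∀ x, g x = p.eval x := by
    intro g hg
    refine Submodule.span_induction ?_ ⟨0, by simp⟩ ?_ ?_ hg
    · rintro _ ⟨i, rfl⟩
      exact ⟨Polynomial.X ^ (i : ℕ), by simp⟩
    · rintro a b - - ⟨p, hp⟩ ⟨q, hq⟩
      exact ⟨p + q, fun x => by simp [hp, hq]⟩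
    · rintro r a - ⟨p, hp⟩
      exact ⟨Polynomial.C r * p, fun x => by simp [hp]⟩
  exact hpoly f hmem

variable {Ω : Type*} [TopologicalSpace Ω]

/-- The function `x ↦ f (w ℓ(x) + b)`. -/
def ridge {f : ℝ → ℝ} (hf : Continuous f) (ℓ : C(Ω, ℝ)) (w b : ℝ) : C(Ω, ℝ) :=
  ⟨fun x => f (w * ℓ x + b), by fun_prop⟩

theorem continuous_ridge_weight {f : ℝ → ℝ} (hf : Continuous f) (ℓ : C(Ω, ℝ)) (b : ℝ) :
    Continuous fun w => ridge hf ℓ w b :=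
  ContinuousMap.continuous_of_continuous_uncurry _ (by
    change Continuous fun p : ℝ × Ω => f (p.1 * ℓ p.2 + b)
    fun_prop)

theorem continuous_ridge_bias {f : ℝ → ℝ} (hf : Continuous f) (ℓ : C(Ω, ℝ)) (w : ℝ) :
    Continuous fun b => ridge hf ℓ w b :=
  ContinuousMap.continuous_of_continuous_uncurry _ (by
    change Continuous fun p : ℝ × Ω => f (w * ℓ p.2 + p.1)
    fun_prop)

theorem mem_of_hasDerivAt {B : Type*} [NormedAddCommGroup B] [NormedSpace ℝ B]
    {M : Submodule ℝ B} (hM : IsClosed (M : Set B)) {c : ℝ → B} {c' : B} {w : ℝ}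
    (hc : HasDerivAt c c' w) (h : ∀ u, c u ∈ M) : c' ∈ M :=
  hM.mem_of_tendsto (hasDerivAt_iff_tendsto_slope.1 hc) (Eventually.of_forall fun u => by
    rw [slope_def_module]
    exact M.smul_mem _ (M.sub_mem (h _) (h _)))

theorem integral_mem_of_isClosed {B : Type*} [NormedAddCommGroup B] [NormedSpace ℝ B]
    [CompleteSpace B] {M : Submodule ℝ B} (hM : IsClosed (M : Set B)) {c : ℝ → B}
    (hc : Continuous c) (hs : HasCompactSupport c) (h : ∀ u, c u ∈ M) : ∫ u, c u ∈ M := by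
  have : CompleteSpace M := hM.completeSpace_coe
  let γ : ℝ → M := fun u => ⟨c u, h u⟩
  have hγ : Continuous γ := hc.subtype_mk _
  have hγs : HasCompactSupport γ := by
    refine hs.mono fun u hu => ?_
    intro h0
    exact hu (Subtype.ext h0)
  have := M.subtypeL.integral_comp_comm (hγ.integrable_of_hasCompactSupport (μ := volume) hγs)
  have h2 : ∫ u, c u = M.subtypeL (∫ u, γ u) := this
  rw [h2]
  exact (∫ u, γ u).2

variable [CompactSpace Ω]

/-- Differentiating `w ↦ ℓ ^ j f(w ℓ + b)` raises the power of `ℓ`. -/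
theorem pow_mul_ridge_deriv_mem {M : Submodule ℝ C(Ω, ℝ)} (hM : IsClosed (M : Set C(Ω, ℝ)))
    {f f' : ℝ → ℝ} (hf : Continuous f) (hf' : Continuous f') (hd : ∀ x, HasDerivAt f (f' x) x)
    (ℓ : C(Ω, ℝ)) (b : ℝ) (j : ℕ) (h : ∀ w, ℓ ^ j * ridge hf ℓ w b ∈ M) (w : ℝ) :
    ℓ ^ (j + 1) * ridge hf' ℓ w b ∈ M := by
  have hγ : Continuous fun u => ℓ ^ (j + 1) * ridge hf' ℓ u b :=
    continuous_const.mul (continuous_ridge_weight hf' ℓ b)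
  have hc : HasDerivAt (fun u => ∫ s in (0 : ℝ)..u, ℓ ^ (j + 1) * ridge hf' ℓ s b)
      (ℓ ^ (j + 1) * ridge hf' ℓ w b) w :=
    intervalIntegral.integral_hasDerivAt_right (hγ.intervalIntegrable _ _)
      hγ.stronglyMeasurable.stronglyMeasurableAtFilter hγ.continuousAt
  refine mem_of_hasDerivAt hM hc fun u => ?_
  have : ∫ s in (0 : ℝ)..u, ℓ ^ (j + 1) * ridge hf' ℓ s b =
      ℓ ^ j * ridge hf ℓ u b - ℓ ^ j * ridge hf ℓ 0 b := by
    ext x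
    have h1 := (ContinuousMap.evalCLM ℝ x : C(Ω, ℝ) →L[ℝ] ℝ).intervalIntegral_comp_comm
      (hγ.intervalIntegrable (μ := volume) 0 u)
    have h2 : (∫ s in (0 : ℝ)..u, ℓ ^ (j + 1) * ridge hf' ℓ s b) x =
        ∫ s in (0 : ℝ)..u, ℓ x ^ (j + 1) * f' (s * ℓ x + b) := h1.symm
    rw [h2, intervalIntegral.integral_eq_sub_of_hasDerivAt
      (f := fun s => ℓ x ^ j * f (s * ℓ x + b))]
    · simp [ridge]
    · intro s _
      have h3 : HasDerivAt (fun s => s * ℓ x + b) (ℓ x) s := by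
        simpa using ((hasDerivAt_id s).mul_const (ℓ x)).add_const b
      have h4 := ((hd (s * ℓ x + b)).comp s h3).const_mul (ℓ x ^ j)
      refine h4.congr_deriv ?_
      ring
    · exact Continuous.intervalIntegrable (by fun_prop) _ _
  rw [this]
  exact M.sub_mem (h u) (h 0)

/-- A closed space that contains the functions `σ(w ℓ + b)` contains all powers of `ℓ`: mollify
`σ` to `f` and differentiate `k` times with respect to `w` at `w = 0`. If `ℓ ^ k` was missing, then
the `k`-th derivative of every `f` would vanish, so that `σ` would be a limit of polynomials of
degree less than `k`. -/
theorem pow_mem_of_ridge_mem {σ : ℝ → ℝ} (hσ : Continuous σ)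
    (hpoly : ¬ ∃ p : Polynomial ℝ, ∀ x, σ x = p.eval x)
    {M : Submodule ℝ C(Ω, ℝ)} (hM : IsClosed (M : Set C(Ω, ℝ)))
    (ℓ : C(Ω, ℝ)) (h : ∀ w b, ridge hσ ℓ w b ∈ M) (k : ℕ) : ℓ ^ k ∈ M := by
  by_contra hk
  -- `F n` is `σ` mollified at scale `1 / (n + 1)`.
  let φ : ℕ → ContDiffBump (0 : ℝ) := fun n =>
    ⟨1 / (2 * (n + 1)), 1 / (n + 1), by positivity, by
      rw [div_lt_div_iff₀ (by positivity) (by positivity)]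
      have : (0 : ℝ) ≤ n := by positivity
      linarith⟩
  have hφ : Tendsto (fun n => (φ n).rOut) atTop (𝓝 0) := tendsto_one_div_add_atTop_nhds_zero_nat
  let F : ℕ → ℝ → ℝ := fun n =>
    convolution ((φ n).normed volume) σ (ContinuousLinearMap.lsmul ℝ ℝ) volume
  have hFs : ∀ n, ContDiff ℝ (⊤ : ℕ∞) (F n) := fun n =>
    (φ n).hasCompactSupport_normed.contDiff_convolution_left _ (φ n).contDiff_normed
      hσ.locallyIntegrable
  refine hpoly (exists_polynomial_of_tendsto k (F := F) (fun n => ?_) fun x =>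
    ContDiffBump.convolution_tendsto_right_of_continuous hφ hσ x)
  have hc : ∀ j, Continuous (iteratedDeriv j (F n)) := fun j =>
    (hFs n).continuous_iteratedDeriv j (by exact_mod_cast le_top)
  have hd : ∀ j x, HasDerivAt (iteratedDeriv j (F n)) (iteratedDeriv (j + 1) (F n) x) x := by
    intro j x
    rw [iteratedDeriv_succ]
    exact ((hFs n).differentiable_iteratedDeriv j (by exact_mod_cast WithTop.coe_lt_top _)
      x).hasDerivAt
  have hmem : ∀ j w b, ℓ ^ j * ridge (hc j) ℓ w b ∈ M := by
    intro j
    induction j with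
    | succ j ih =>
      intro w b
      exact pow_mul_ridge_deriv_mem hM (hc j) (hc (j + 1)) (hd j) ℓ b j (fun w => ih w b) w
    | zero =>
      intro w b
      have hcont : Continuous fun s => (φ n).normed volume s • ridge hσ ℓ w (b - s) :=
        (φ n).continuous_normed.smul ((continuous_ridge_bias hσ ℓ w).comp (by fun_prop))
      have hsupp : HasCompactSupport fun s => (φ n).normed volume s • ridge hσ ℓ w (b - s) :=
        (φ n).hasCompactSupport_normed.smul_right
      have hint := integral_mem_of_isClosed hM hcont hsupp fun s => M.smul_mem _ (h w (b - s))
      convert! hint using 1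
      ext x
      have h1 := (ContinuousMap.evalCLM ℝ x : C(Ω, ℝ) →L[ℝ] ℝ).integral_comp_comm
        (hcont.integrable_of_hasCompactSupport hsupp (μ := volume))
      have h2 : (∫ s, (φ n).normed volume s • ridge hσ ℓ w (b - s)) x =
        ∫ s, (φ n).normed volume s * σ (w * ℓ x + (b - s)) := h1.symm
      rw [h2]
      simp [ridge, F, convolution, add_sub_assoc]
  refine exists_coeff_of_iteratedDeriv_eq_zero k (hFs n) fun b => ?_
  by_contra hb
  -- At `w = 0` the member of `M` given by `hmem` is a multiple of `ℓ ^ k`.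
  have h0 := M.smul_mem (iteratedDeriv k (F n) b)⁻¹ (hmem k 0 b)
  refine hk ?_
  convert! h0 using 1
  ext x
  simp [ridge]
  field_simp

/-- A closed space of functions that contains `σ(ℓ + b)` for all `b` and all `ℓ` in a linear space
that separates points is everything: it contains the functions `exp ℓ = ∑ ℓ ^ k / k!`, which span
an algebra. -/
theorem eq_top_of_ridge_mem {σ : ℝ → ℝ} (hσ : Continuous σ)
    (hpoly : ¬ ∃ p : Polynomial ℝ, ∀ x, σ x = p.eval x)
    {M : Submodule ℝ C(Ω, ℝ)} (hM : IsClosed (M : Set C(Ω, ℝ))) (Λ : Submodule ℝ C(Ω, ℝ))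
    (hsep : ∀ x y, x ≠ y → ∃ ℓ ∈ Λ, ℓ x ≠ ℓ y)
    (h : ∀ ℓ ∈ Λ, ∀ b, ridge hσ ℓ 1 b ∈ M) : M = ⊤ := by
  have hridge : ∀ ℓ ∈ Λ, ∀ w b, ridge hσ ℓ w b ∈ M := by
    intro ℓ hℓ w b
    convert! h (w • ℓ) (Λ.smul_mem w hℓ) b using 1
    ext x
    simp [ridge]
  let s : Set C(Ω, ℝ) := {g | ∃ ℓ ∈ Λ, g = NormedSpace.exp ℓ}
  have hsM : s ⊆ M := by
    rintro _ ⟨ℓ, hℓ, rfl⟩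
    refine hM.mem_of_tendsto (NormedSpace.exp_series_hasSum_exp' (𝕂 := ℝ) ℓ)
      (Eventually.of_forall fun n => ?_)
    exact M.sum_mem fun k _ => M.smul_mem _
      (pow_mem_of_ridge_mem hσ hpoly hM ℓ (hridge ℓ hℓ) k)
  have hcl : (Submonoid.closure s : Set C(Ω, ℝ)) ⊆ s := by
    intro g hg
    refine Submonoid.closure_induction (fun x hx => hx) ⟨0, Λ.zero_mem, by simp⟩ ?_ hg
    rintro _ _ - - ⟨ℓ, hℓ, rfl⟩ ⟨ℓ', hℓ', rfl⟩
    exact ⟨ℓ + ℓ', Λ.add_mem hℓ hℓ', (NormedSpace.exp_add).symm⟩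
  have hle : Subalgebra.toSubmodule (Algebra.adjoin ℝ s) ≤ M := by
    rw [Algebra.adjoin_eq_span, Submodule.span_le]
    exact hcl.trans hsM
  have hexp : ∀ (ℓ : C(Ω, ℝ)) x, (NormedSpace.exp ℓ) x = Real.exp (ℓ x) := by
    intro ℓ x
    have := NormedSpace.map_exp (ContinuousMap.evalAlgHom ℝ ℝ x : C(Ω, ℝ) →ₐ[ℝ] ℝ)
      (continuous_eval_const x) ℓ
    rw [Real.exp_eq_exp_ℝ]
    exact this
  have hdense := ContinuousMap.subalgebra_topologicalClosure_eq_top_of_separatesPoints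
    (Algebra.adjoin ℝ s) (by
      intro x y hxy
      obtain ⟨ℓ, hℓ, hne⟩ := hsep x y hxy
      refine ⟨_, ⟨NormedSpace.exp ℓ, Algebra.subset_adjoin ⟨ℓ, hℓ, rfl⟩, rfl⟩, ?_⟩
      simpa [hexp] using hne)
  rw [eq_top_iff]
  intro g _
  have hg : g ∈ (Algebra.adjoin ℝ s).topologicalClosure := hdense ▸ Algebra.mem_top
  have hg' : g ∈ closure ((Algebra.adjoin ℝ s : Subalgebra ℝ C(Ω, ℝ)) : Set C(Ω, ℝ)) := hg
  exact closure_minimal (fun a ha => hle ha) hM hg'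

end Density

section NeuronSpan

variable {E : Type*} [AddCommGroup E] [Module ℝ E]

/-- The functions computed by single-hidden-layer networks on `E` with activation `σ`, whose hidden
units read their input through functionals in `Λ`. There is no output bias: constants are multiples
of a unit with zero weights. -/
def neuronSpan (σ : ℝ → ℝ) (Λ : Submodule ℝ (Module.Dual ℝ E)) : Submodule ℝ (E → ℝ) :=
  Submodule.span ℝ {g | ∃ ℓ ∈ Λ, ∃ b : ℝ, g = fun x => σ (ℓ x + b)}

variable {σ : ℝ → ℝ} {Λ : Submodule ℝ (Module.Dual ℝ E)}

/-- Networks are dense in the continuous functions on a compact space that is mapped to `E` in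
such a way that the functionals in `Λ` separate its points. -/
theorem exists_neuronSpan_approx (hσ : Continuous σ)
    (hpoly : ¬ ∃ p : Polynomial ℝ, ∀ x, σ x = p.eval x)
    {Ω : Type*} [TopologicalSpace Ω] [CompactSpace Ω] (e : Ω → E)
    (hc : ∀ ℓ ∈ Λ, Continuous fun x => ℓ (e x))
    (hsep : ∀ x y, x ≠ y → ∃ ℓ ∈ Λ, ℓ (e x) ≠ ℓ (e y)) (T : C(Ω, ℝ)) {ε : ℝ} (hε : 0 < ε) :
    ∃ g ∈ neuronSpan σ Λ, ∀ x, |g (e x) - T x| ≤ ε := by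
  let S : Submodule ℝ C(Ω, ℝ) := Submodule.span ℝ
    {g | ∃ ℓ ∈ Λ, ∃ b : ℝ, ∀ x, g x = σ (ℓ (e x) + b)}
  let Λ' : Submodule ℝ C(Ω, ℝ) :=
    { carrier := {g | ∃ ℓ ∈ Λ, ∀ x, g x = ℓ (e x)}
      add_mem' := by
        rintro _ _ ⟨ℓ, hℓ, h⟩ ⟨ℓ', hℓ', h'⟩
        exact ⟨ℓ + ℓ', Λ.add_mem hℓ hℓ', fun x => by simp [h, h']⟩
      zero_mem' := ⟨0, Λ.zero_mem, by simp⟩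
      smul_mem' := by
        rintro r _ ⟨ℓ, hℓ, h⟩
        exact ⟨r • ℓ, Λ.smul_mem r hℓ, fun x => by simp [h]⟩ }
  have htop : S.topologicalClosure = ⊤ := by
    refine eq_top_of_ridge_mem hσ hpoly S.isClosed_topologicalClosure Λ' ?_ ?_
    · intro x y hxy
      obtain ⟨ℓ, hℓ, hne⟩ := hsep x y hxy
      exact ⟨⟨_, hc ℓ hℓ⟩, ⟨ℓ, hℓ, fun _ => rfl⟩, hne⟩
    · rintro g ⟨ℓ, hℓ, hg⟩ b
      refine S.le_topologicalClosure (Submodule.subset_span ⟨ℓ, hℓ, b, fun x => ?_⟩)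
      simp [ridge, hg]
  have hT : T ∈ closure (S : Set C(Ω, ℝ)) := by
    have : T ∈ S.topologicalClosure := htop ▸ Submodule.mem_top
    exact this
  obtain ⟨g, hg, hgT⟩ := Metric.mem_closure_iff.1 hT ε hε
  have hlift : ∃ g' ∈ neuronSpan σ Λ, ∀ x, g x = g' (e x) := by
    refine Submodule.span_induction ?_ ⟨0, Submodule.zero_mem _, by simp⟩ ?_ ?_ hg
    · rintro h ⟨ℓ, hℓ, b, hh⟩
      exact ⟨_, Submodule.subset_span ⟨ℓ, hℓ, b, rfl⟩, hh⟩
    · rintro a b - - ⟨a', ha', ha⟩ ⟨b', hb', hb⟩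
      exact ⟨a' + b', Submodule.add_mem _ ha' hb', fun x => by simp [ha, hb]⟩
    · rintro r a - ⟨a', ha', ha⟩
      exact ⟨r • a', Submodule.smul_mem _ r ha', fun x => by simp [ha]⟩
  obtain ⟨g', hg', hgg'⟩ := hlift
  refine ⟨g', hg', fun x => ?_⟩
  rw [← hgg', ← Real.dist_eq, dist_comm]
  exact (ContinuousMap.dist_apply_le_dist x).trans hgT.le

/-- Networks interpolate arbitrary values at finitely many points. -/
theorem exists_neuronSpan_interpolate (hσ : Continuous σ)
    (hpoly : ¬ ∃ p : Polynomial ℝ, ∀ x, σ x = p.eval x) {N : Type*} [Fintype N] (e : N → E)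
    (hsep : ∀ x y, x ≠ y → ∃ ℓ ∈ Λ, ℓ (e x) ≠ ℓ (e y)) (T : N → ℝ) :
    ∃ g ∈ neuronSpan σ Λ, ∀ n, g (e n) = T n := by
  let _ : TopologicalSpace N := ⊥
  have : DiscreteTopology N := ⟨rfl⟩
  let R : Submodule ℝ (N → ℝ) := (neuronSpan σ Λ).map (LinearMap.funLeft ℝ ℝ e)
  have hR : IsClosed (R : Set (N → ℝ)) := R.closed_of_finiteDimensional
  have hT : T ∈ closure (R : Set (N → ℝ)) := by
    refine Metric.mem_closure_iff.2 fun ε hε => ?_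
    obtain ⟨g, hg, h⟩ := exists_neuronSpan_approx hσ hpoly e
      (fun _ _ => continuous_of_discreteTopology) hsep ⟨T, continuous_of_discreteTopology⟩
      (half_pos hε)
    refine ⟨_, ⟨g, hg, rfl⟩, lt_of_le_of_lt ?_ (half_lt_self hε)⟩
    rw [dist_comm, dist_pi_le_iff (half_pos hε).le]
    exact fun n => by simpa [Real.dist_eq] using h n
  rw [hR.closure_eq] at hT
  obtain ⟨g, hg, h⟩ := hT
  exact ⟨g, hg, fun n => congrFun h n⟩

/-- Finitely many networks share one hidden layer. -/
theorem exists_hidden_layer {β : Type*} [Finite β] (Φ : β → E → ℝ)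
    (h : ∀ b, Φ b ∈ neuronSpan σ Λ) : ∃ (n : ℕ) (ℓ : Fin n → Module.Dual ℝ E) (b : Fin n → ℝ)
      (a : β → Fin n → ℝ), (∀ r, ℓ r ∈ Λ) ∧ ∀ i x, Φ i x = ∑ r, a i r * σ (ℓ r x + b r) := by
  have hone : ∀ g ∈ neuronSpan σ Λ, ∃ (n : ℕ) (ℓ : Fin n → Module.Dual ℝ E) (b a : Fin n → ℝ),
      (∀ r, ℓ r ∈ Λ) ∧ ∀ x, g x = ∑ r, a r * σ (ℓ r x + b r) := by
    intro g hg
    refine Submodule.span_induction ?_ ?_ ?_ ?_ hg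
    · rintro _ ⟨ℓ, hℓ, b, rfl⟩
      exact ⟨1, fun _ => ℓ, fun _ => b, fun _ => 1, fun _ => hℓ, by simp⟩
    · exact ⟨0, Fin.elim0, Fin.elim0, Fin.elim0, fun r => r.elim0, by simp⟩
    · rintro f g - - ⟨n, ℓ, b, a, hℓ, hf⟩ ⟨n', ℓ', b', a', hℓ', hg⟩
      refine ⟨n + n', Fin.append ℓ ℓ', Fin.append b b', Fin.append a a', fun r => ?_, fun x => ?_⟩
      · refine Fin.addCases (fun i => ?_) (fun i => ?_) r
        · simpa using hℓ i
        · simpa using hℓ' i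
      · simp [Fin.sum_univ_add, hf, hg]
    · rintro r f - ⟨n, ℓ, b, a, hℓ, hf⟩
      exact ⟨n, ℓ, b, fun i => r * a i, hℓ, fun x => by simp [hf, Finset.mul_sum, mul_assoc]⟩
  have := Fintype.ofFinite β
  classical
  choose n ℓ b a hℓ hg using fun i => hone (Φ i) (h i)
  let eq := Fintype.equivFin (Σ i, Fin (n i))
  refine ⟨_, fun r => ℓ (eq.symm r).1 (eq.symm r).2, fun r => b (eq.symm r).1 (eq.symm r).2,
    fun i r => if (eq.symm r).1 = i then a (eq.symm r).1 (eq.symm r).2 else 0,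
    fun r => hℓ _ _, fun i x => ?_⟩
  rw [eq.symm.sum_comp (fun q : Σ i, Fin (n i) => (if q.1 = i then a q.1 q.2 else 0) *
    σ (ℓ q.1 q.2 x + b q.1 q.2)), Fintype.sum_sigma, Finset.sum_eq_single i]
  · simp [hg]
  · intro j _ hj
    simp [hj]
  · simp

theorem exists_ne_zero_of_not_polynomial
    (hpoly : ¬ ∃ p : Polynomial ℝ, ∀ x, σ x = p.eval x) : ∃ z, σ z ≠ 0 := by
  by_contra! h
  exact hpoly ⟨0, by simpa using h⟩

theorem const_mem_neuronSpan (hpoly : ¬ ∃ p : Polynomial ℝ, ∀ x, σ x = p.eval x) (r : ℝ) :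
    (fun _ => r) ∈ neuronSpan σ Λ := by
  obtain ⟨z, hz⟩ := exists_ne_zero_of_not_polynomial hpoly
  have := (neuronSpan σ Λ).smul_mem (r / σ z) (Submodule.subset_span ⟨0, Λ.zero_mem, z, rfl⟩)
  convert! this using 1
  ext x
  simp [hz]

/-- A family of networks is computed by one two-layer perceptron, whose weights represent
functionals in `Λ`. -/
theorem exists_twoLayerMLP {α β : Type} [Fintype α] [DecidableEq α] [Finite β]
    {Λ : Submodule ℝ (Module.Dual ℝ (α → ℝ))} (Φ : β → (α → ℝ) → ℝ)
    (h : ∀ b, Φ b ∈ neuronSpan σ Λ) : ∃ φ : TwoLayerMLP α β, (∀ x i, φ.eval σ x i = Φ i x) ∧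
      ∀ r, ∃ ℓ ∈ Λ, ∀ j, φ.A₁ r j = ℓ (Pi.single j 1) := by
  obtain ⟨n, ℓ, b, a, hℓ, hΦ⟩ := exists_hidden_layer Φ h
  refine ⟨⟨n, Matrix.of fun r j => ℓ r (Pi.single j 1), b, Matrix.of a, 0⟩, fun x i => ?_,
    fun r => ⟨ℓ r, hℓ r, fun j => rfl⟩⟩
  simp only [TwoLayerMLP.eval, Matrix.mulVec, dotProduct, Pi.add_apply, Matrix.of_apply,
    Pi.zero_apply, add_zero, hΦ]
  refine Finset.sum_congr rfl fun r _ => ?_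
  congr 3
  rw [(LinearMap.pi_apply_eq_sum_univ (ℓ r) x)]
  exact Finset.sum_congr rfl fun j _ => by
    rw [smul_eq_mul, mul_comm]
    congr 2
    ext k
    simp [Pi.single_apply, eq_comm]

end NeuronSpan

/-! ### Layers with prescribed channels -/

section Embedding

variable {T : Type*} {d : ℕ}

theorem sum_extend_mul [Fintype T] (e : T ↪ Fin d) (g : T → ℝ) (y : Fin d → ℝ) :
    ∑ i, Function.extend e g 0 i * y i = ∑ s, g s * y (e s) := by
  refine (Fintype.sum_of_injective e e.injective _ _ (fun i hi => ?_) fun s => ?_).symm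
  · rw [Function.extend_apply' _ _ _ fun ⟨s, hs⟩ => hi ⟨s, hs⟩]
    simp
  · rw [e.injective.extend_apply]

/-- The matrix on all channels with the given entries on the image of `e` and zeros elsewhere. -/
noncomputable def extendMatrix (e : T ↪ Fin d) (W : T → T → ℝ) : Matrix (Fin d) (Fin d) ℝ :=
  Matrix.of fun i j => Function.extend e (fun r => Function.extend e (W r) 0 j) 0 i

theorem extendMatrix_mulVec [Fintype T] (e : T ↪ Fin d) (W : T → T → ℝ) (x : Fin d → ℝ) (r : T) :
    (extendMatrix e W *ᵥ x) (e r) = ∑ s, W r s * x (e s) := by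
  simp only [Matrix.mulVec, dotProduct, extendMatrix, Matrix.of_apply, e.injective.extend_apply]
  exact sum_extend_mul e (W r) x

/-- The encoder that sends the input through the functionals `g s` to the channels `e s`. -/
noncomputable def encoder (e : T ↪ Fin d) {n : ℕ} (g : T → Fin n → ℝ) :
    Matrix (Fin d) (Fin n) ℝ :=
  Matrix.of fun i k => Function.extend e (fun s => g s k) 0 i

theorem encoder_mulVec (e : T ↪ Fin d) {n : ℕ} (g : T → Fin n → ℝ) (x : Fin n → ℝ) (s : T) :
    (encoder e g *ᵥ x) (e s) = ∑ k, g s k * x k := by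
  simp only [Matrix.mulVec, dotProduct, encoder, Matrix.of_apply, e.injective.extend_apply]

/-- The decoder that reads the channels `e s` with the weights `g μ s`. -/
noncomputable def decoder (e : T ↪ Fin d) {m : ℕ} (g : Fin m → T → ℝ) :
    Matrix (Fin m) (Fin d) ℝ :=
  Matrix.of fun μ => Function.extend e (g μ) 0

theorem decoder_mulVec [Fintype T] (e : T ↪ Fin d) {m : ℕ} (g : Fin m → T → ℝ)
    (x : Fin d → ℝ) (μ : Fin m) :
    (decoder e g *ᵥ x) μ = ∑ s, g μ s * x (e s) :=
  sum_extend_mul e (g μ) x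

end Embedding

/-- The coordinate `s` of the image of `x` under the product of the reflections along the vectors
`w k`, provided that these are pairwise orthogonal; a zero vector contributes nothing. -/
noncomputable def reflections {T : Type*} [Fintype T] (w : T → T → ℝ) (x : T → ℝ) (s : T) : ℝ :=
  x s - ∑ k, 2 * (∑ j, w k j * x j) / (∑ j, w k j * w k j) * w k s

theorem continuous_of_mem_neuronSpan {α : Type*} [Finite α] {σ : ℝ → ℝ} (hσ : Continuous σ)
    {Λ : Submodule ℝ (Module.Dual ℝ (α → ℝ))} {g : (α → ℝ) → ℝ} (hg : g ∈ neuronSpan σ Λ) :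
    Continuous g := by
  have := Fintype.ofFinite α
  refine Submodule.span_induction ?_ continuous_const ?_ ?_ hg
  · rintro _ ⟨ℓ, -, b, rfl⟩
    have := ℓ.continuous_of_finiteDimensional
    fun_prop
  · exact fun _ _ _ _ h h' => h.add h'
  · exact fun r _ _ h => h.const_smul r

/-- The functionals of a positional encoding and a signal that ignore the signal. -/
def positionalDual (f d : ℕ) : Submodule ℝ (Module.Dual ℝ (Fin f ⊕ Fin d → ℝ)) where
  carrier := {ℓ | ∀ p x, ℓ (Sum.elim p x) = ℓ (Sum.elim p 0)}
  add_mem' h h' p x := by simp [h p x, h' p x]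
  zero_mem' p x := by simp
  smul_mem' r ℓ h p x := by simp [h p x]

theorem neuronSpan_positionalDual_apply {f d : ℕ} {σ : ℝ → ℝ} {g : (Fin f ⊕ Fin d → ℝ) → ℝ}
    (hg : g ∈ neuronSpan σ (positionalDual f d)) (p : Fin f → ℝ) (x : Fin d → ℝ) :
    g (Sum.elim p x) = g (Sum.elim p 0) := by
  refine Submodule.span_induction ?_ rfl ?_ ?_ hg
  · rintro _ ⟨ℓ, hℓ, b, rfl⟩
    simp only
    rw [hℓ p x]
  · intro a b _ _ ha hb
    simp [ha, hb]
  · intro r a _ ha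
    simp [ha]

/-- A layer whose reflections are given networks and pairwise orthogonal, on the channels in the
image of `e`. The channels in which all its reflection vectors vanish are not transported. -/
theorem exists_layer {σ : ℝ → ℝ} (hσ : Continuous σ) {T : Type*} [Fintype T] {f d : ℕ}
    (e : T ↪ Fin d) (W : T → T → ℝ) (b : T → ℝ)
    {Λ : Submodule ℝ (Module.Dual ℝ (Fin f ⊕ Fin d → ℝ))}
    (Φ : T → T → (Fin f ⊕ Fin d → ℝ) → ℝ) (hΦ : ∀ k j, Φ k j ∈ neuronSpan σ Λ)
    (horth : ∀ y k l, k ≠ l → ∑ j, Φ k j y * Φ l j y = 0) :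
    ∃ L : Layer f d, (Λ ≤ positionalDual f d → L.IsPositional) ∧
      ((∀ k, (∀ j, Φ k j = 0) ∨ ∀ y, ∑ j, Φ k j y * Φ k j y ≠ 0) →
        ∀ p, Continuous fun x => L.bundleMap σ p x) ∧
      ∀ (V : Type*) [Fintype V] [DecidableEq V] (G : SimpleGraph V) [DecidableRel G.Adj] (t : ℝ)
        (P : V → Fin f → ℝ) (X : V → Fin d → ℝ) (v : V) (r : T), (∀ k, Φ k r = 0) →
        L.eval σ G t P X v (e r) = σ (∑ u, heat G t v u *
          ∑ s, W r s * reflections (fun k j => Φ k j (Sum.elim (P u) (X u))) (X u ∘ e) s + b r) := by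
  classical
  let Ψ : Fin d × Fin d → (Fin f ⊕ Fin d → ℝ) → ℝ := fun q =>
    Function.extend e (fun k => Function.extend e (Φ k) 0 q.2) 0 q.1
  have hΨ₀ : ∀ k j, Ψ (e k, e j) = Φ k j := fun k j => by
    simp [Ψ, e.injective.extend_apply]
  have hΨ₁ : ∀ k j, (¬ ∃ k', e k' = k) → Ψ (k, j) = 0 := fun k j hk => by
    simp only [Ψ]
    rw [Function.extend_apply' _ _ _ hk, Pi.zero_apply]
  have hΨ₂ : ∀ k j, (¬ ∃ j', e j' = j) → Ψ (k, j) = 0 := fun k j hj => by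
    by_cases hk : ∃ k', e k' = k
    · obtain ⟨k', rfl⟩ := hk
      simp only [Ψ, e.injective.extend_apply]
      rw [Function.extend_apply' _ _ _ hj, Pi.zero_apply]
    · exact hΨ₁ k j hk
  have hΨmem : ∀ q, Ψ q ∈ neuronSpan σ Λ := by
    rintro ⟨k, j⟩
    by_cases hk : ∃ k', e k' = k
    · by_cases hj : ∃ j', e j' = j
      · obtain ⟨k', rfl⟩ := hk
        obtain ⟨j', rfl⟩ := hj
        rw [hΨ₀]
        exact hΦ k' j'
      · rw [hΨ₂ k j hj]
        exact Submodule.zero_mem _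
    · rw [hΨ₁ k j hk]
      exact Submodule.zero_mem _
  have hsum : ∀ k y (z : Fin d → ℝ), ∑ j, Ψ (e k, j) y * z j = ∑ j, Φ k j y * z (e j) := by
    intro k y z
    refine (Fintype.sum_of_injective e e.injective _ _ (fun j hj => ?_) fun j => ?_).symm
    · rw [hΨ₂ _ j fun ⟨s, hs⟩ => hj ⟨s, hs⟩]
      simp
    · rw [hΨ₀]
  obtain ⟨φ, hφ, hφ'⟩ := exists_twoLayerMLP Ψ hΨmem
  let L : Layer f d := ⟨φ, extendMatrix e W, Function.extend e b 0⟩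
  have hvec : ∀ p x, L.bundleMap σ p x =
      householderProd fun k j => Ψ (k, j) (Sum.elim p x) := by
    intro p x
    simp only [Layer.bundleMap, L, hφ]
  have hpair : ∀ y, Pairwise fun k l : Fin d =>
      (fun j => Ψ (k, j) y) ⬝ᵥ (fun j => Ψ (l, j) y) = 0 := by
    intro y k l hkl
    by_cases hk : ∃ k', e k' = k
    · by_cases hl : ∃ l', e l' = l
      · obtain ⟨k', rfl⟩ := hk
        obtain ⟨l', rfl⟩ := hl
        rw [dotProduct, hsum k' y fun j => Ψ (e l', j) y]
        simp only [hΨ₀]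
        exact horth y k' l' fun h => hkl (by rw [h])
      · simp [dotProduct, hΨ₁ l _ hl]
    · simp [dotProduct, hΨ₁ k _ hk]
  have hrefl : ∀ p x s, (L.bundleMap σ p x *ᵥ x) (e s) =
      reflections (fun k j => Φ k j (Sum.elim p x)) (x ∘ e) s := by
    intro p x s
    rw [hvec, householderProd_mulVec_of_orthogonal _ (hpair _), reflections, Pi.sub_apply,
      Finset.sum_apply]
    congr 1
    refine (Fintype.sum_of_injective e e.injective _ _ (fun k hk => ?_) fun k => ?_).symm
    · simp [hΨ₁ k _ fun ⟨s, hs⟩ => hk ⟨s, hs⟩]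
    · rw [Pi.smul_apply, dotProduct, dotProduct, hsum, hsum, hΨ₀, smul_eq_mul]
      simp only [hΨ₀, Function.comp_apply]
  refine ⟨L, fun hΛ r j => ?_, fun hne p => ?_, ?_⟩
  · obtain ⟨ℓ, hℓ, h⟩ := hφ' r
    have h0 := hΛ hℓ 0 (Pi.single j 1)
    change φ.A₁ r (Sum.inr j) = 0
    rw [h]
    have h1 : (Pi.single (Sum.inr j) 1 : Fin f ⊕ Fin d → ℝ) =
        Sum.elim (0 : Fin f → ℝ) (Pi.single j (1 : ℝ)) := by
      ext (i | i) <;> simp [Pi.single_apply]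
    have h2 : Sum.elim (0 : Fin f → ℝ) (0 : Fin d → ℝ) = 0 := by
      ext (i | i) <;> rfl
    rw [h1, h0, h2, map_zero]
  · simp_rw [hvec, householderProd, List.ofFn_eq_map]
    refine continuous_list_prod _ fun k _ => ?_
    have hin : Continuous fun x : Fin d → ℝ => (Sum.elim p x : Fin f ⊕ Fin d → ℝ) := by
      refine continuous_pi fun i => ?_
      rcases i with i | i
      · exact continuous_const
      · exact continuous_apply i
    have hcont : ∀ j, Continuous fun x : Fin d → ℝ => Ψ (k, j) (Sum.elim p x) := fun j =>
      (continuous_of_mem_neuronSpan hσ (hΨmem _)).comp hin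
    have hzero : (∀ j, Ψ (k, j) = 0) → Continuous fun x : Fin d → ℝ =>
        householder fun j => Ψ (k, j) (Sum.elim p x) := by
      intro h0
      simp only [h0, Pi.zero_apply]
      exact continuous_const
    by_cases hk : ∃ k', e k' = k
    · obtain ⟨k', rfl⟩ := hk
      rcases hne k' with h0 | h0
      · refine hzero fun j => ?_
        by_cases hj : ∃ j', e j' = j
        · obtain ⟨j', rfl⟩ := hj
          rw [hΨ₀, h0]
        · exact hΨ₂ _ _ hj
      · have hnz : ∀ x : Fin d → ℝ, (fun j => Ψ (e k', j) (Sum.elim p x)) ⬝ᵥ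
            (fun j => Ψ (e k', j) (Sum.elim p x)) ≠ 0 := by
          intro x
          rw [dotProduct, hsum]
          simp only [hΨ₀]
          exact h0 _
        unfold householder
        refine continuous_const.sub (Continuous.smul (continuous_const.div ?_ hnz) ?_)
        · exact Continuous.dotProduct (continuous_pi hcont) (continuous_pi hcont)
        · exact Continuous.matrix_vecMulVec (continuous_pi hcont) (continuous_pi hcont)
    · exact hzero fun j => hΨ₁ k j hk
  · intro V _ _ G _ t P X v r hr
    rw [Layer.eval, diffuse_apply_of_fixed]
    · simp only [L, e.injective.extend_apply, extendMatrix_mulVec]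
      congr 3
      ext u
      congr 2
      ext s
      congr 1
      exact hrefl (P u) (X u) s
    · intro u k
      change φ.eval σ _ (k, e r) = 0
      rw [hφ]
      by_cases hk : ∃ k', e k' = k
      · obtain ⟨k', rfl⟩ := hk
        rw [hΨ₀, hr]
        rfl
      · rw [hΨ₁ k _ hk]
        rfl

/-- A positional layer that gathers the signals of all nodes. Every input channel is present in an
untransported copy and, for each node label, in a copy whose sign is flipped at the nodes with that
label only; half the difference of the two is the signal of the labelled node. -/
theorem exists_gather_layer {σ : ℝ → ℝ} (hσ : Continuous σ)
    (hpoly : ¬ ∃ p : Polynomial ℝ, ∀ x, σ x = p.eval x) {N R : Type*} [Fintype N] [Fintype R]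
    {f n d m : ℕ} (e : (Fin n ⊕ N × Fin n) ⊕ R ↪ Fin d) (π : N → Fin f → ℝ)
    (hπ : Function.Injective π) (A : R → N → Fin n → ℝ) (b : R → ℝ) (a : Fin m → R → ℝ) :
    ∃ (L : Layer f d) (enc : Matrix (Fin d) (Fin n) ℝ) (dec : Matrix (Fin m) (Fin d) ℝ),
      L.IsPositional ∧ ∀ (V : Type*) [Fintype V] [DecidableEq V] (G : SimpleGraph V)
        [DecidableRel G.Adj] (t : ℝ) (ν : V → N) (P : V → Fin f → ℝ), (∀ v, P v = π (ν v)) →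
        ∀ (X : V → Fin n → ℝ) (v : V) (μ : Fin m),
          (dec *ᵥ L.eval σ G t P (fun u => enc *ᵥ X u) v) μ =
            ∑ r, a μ r * σ (∑ u, heat G t v u * ∑ k, A r (ν u) k * X u k + b r) := by
  classical
  have hsep : ∀ x y : N, x ≠ y → ∃ ℓ ∈ positionalDual f d,
      ℓ (Sum.elim (π x) 0) ≠ ℓ (Sum.elim (π y) 0) := by
    intro x y hxy
    obtain ⟨i, hi⟩ := Function.ne_iff.1 (hπ.ne hxy)
    exact ⟨LinearMap.proj (Sum.inl i), fun p x => by simp, by simpa using hi⟩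
  choose g hg hgv using fun n₀ : N => exists_neuronSpan_interpolate hσ hpoly
    (fun n : N => (Sum.elim (π n) 0 : Fin f ⊕ Fin d → ℝ)) hsep (fun n => if n = n₀ then 1 else 0)
  -- `g n₀` is the indicator of the label `n₀`, so the flipped copy is reflected along its axis at
  -- the nodes with that label, and the zero vector leaves it alone elsewhere.
  let Φ : (Fin n ⊕ N × Fin n) ⊕ R → (Fin n ⊕ N × Fin n) ⊕ R → (Fin f ⊕ Fin d → ℝ) → ℝ
    | Sum.inl (Sum.inr q), j => if j = Sum.inl (Sum.inr q) then g q.1 else 0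
    | _, _ => 0
  -- Half the difference of the two copies, summed over the labels.
  let W : (Fin n ⊕ N × Fin n) ⊕ R → (Fin n ⊕ N × Fin n) ⊕ R → ℝ
    | Sum.inr r, Sum.inl (Sum.inl k) => ∑ n₀, A r n₀ k / 2
    | Sum.inr r, Sum.inl (Sum.inr q) => -(A r q.1 q.2 / 2)
    | _, _ => 0
  let ι : (Fin n ⊕ N × Fin n) ⊕ R → Fin n → ℝ
    | Sum.inl (Sum.inl k), j => if j = k then 1 else 0
    | Sum.inl (Sum.inr q), j => if j = q.2 then 1 else 0
    | Sum.inr _, _ => 0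
  have hΦmem : ∀ k j, Φ k j ∈ neuronSpan σ (positionalDual f d) := by
    rintro ((k | q) | r) j
    · exact Submodule.zero_mem _
    · simp only [Φ]
      split_ifs
      · exact hg _
      · exact Submodule.zero_mem _
    · exact Submodule.zero_mem _
  have horth : ∀ y k l, k ≠ l → ∑ j, Φ k j y * Φ l j y = 0 := by
    intro y k l hkl
    refine Finset.sum_eq_zero fun j _ => ?_
    rcases k with (k | q) | r
    · simp [Φ]
    · rcases l with (l | q') | r'
      · simp [Φ]
      · by_cases hj : j = Sum.inl (Sum.inr q)
        · have : j ≠ Sum.inl (Sum.inr q') := fun h => hkl (hj.symm.trans h)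
          simp [Φ, this]
        · simp [Φ, hj]
      · simp [Φ]
    · simp [Φ]
  obtain ⟨L, hLpos, -, hL⟩ := exists_layer hσ e W (Sum.elim 0 b) Φ hΦmem horth
  refine ⟨L, encoder e ι, decoder e fun μ => Sum.elim 0 (a μ), hLpos le_rfl, ?_⟩
  intro V _ _ G _ t ν P hP X v μ
  have hfixed : ∀ (r : R) k, Φ k (Sum.inr r) = 0 := by
    rintro r ((k | q) | r') <;> simp [Φ]
  rw [decoder_mulVec, Fintype.sum_sum_type]
  simp only [Sum.elim_inl, Sum.elim_inr, Pi.zero_apply, zero_mul, Finset.sum_const_zero, zero_add]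
  refine Finset.sum_congr rfl fun r _ => ?_
  rw [hL V G t P _ v (Sum.inr r) (hfixed r), Sum.elim_inr]
  congr 3
  refine Finset.sum_congr rfl fun u _ => ?_
  congr 1
  set x : Fin d → ℝ := encoder e ι *ᵥ X u with hx
  have hx₀ : ∀ k, x (e (Sum.inl (Sum.inl k))) = X u k := by
    intro k
    rw [hx, encoder_mulVec]
    simp [ι]
  have hx₁ : ∀ q, x (e (Sum.inl (Sum.inr q))) = X u q.2 := by
    intro q
    rw [hx, encoder_mulVec]
    simp [ι]
  have hgu : ∀ n₀, g n₀ (Sum.elim (P u) x) = if ν u = n₀ then 1 else 0 := by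
    intro n₀
    rw [neuronSpan_positionalDual_apply (hg n₀), hP, hgv n₀ (ν u)]
  have hr₀ : ∀ k, reflections (fun k j => Φ k j (Sum.elim (P u) x)) (x ∘ e)
      (Sum.inl (Sum.inl k)) = X u k := by
    intro k
    rw [reflections, Finset.sum_eq_zero]
    · simp [hx₀]
    · rintro ((l | q) | r') - <;> simp [Φ]
  have hr₁ : ∀ q, reflections (fun k j => Φ k j (Sum.elim (P u) x)) (x ∘ e)
      (Sum.inl (Sum.inr q)) = X u q.2 - 2 * if ν u = q.1 then X u q.2 else 0 := by
    intro q
    rw [reflections, Finset.sum_eq_single (Sum.inl (Sum.inr q))]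
    · have h1 : ∀ z : (Fin n ⊕ N × Fin n) ⊕ R → ℝ,
          ∑ j, Φ (Sum.inl (Sum.inr q)) j (Sum.elim (P u) x) * z j =
            g q.1 (Sum.elim (P u) x) * z (Sum.inl (Sum.inr q)) := by
        intro z
        rw [Finset.sum_eq_single (Sum.inl (Sum.inr q))]
        · simp [Φ]
        · intro j _ hj
          simp [Φ, hj]
        · simp
      rw [h1, h1]
      simp only [Φ, if_true, hgu, Function.comp_apply, hx₁]
      split_ifs <;> simp
    · rintro ((l | q') | r') - hne
      · simp [Φ]
      · have : (Sum.inl (Sum.inr q) : (Fin n ⊕ N × Fin n) ⊕ R) ≠ Sum.inl (Sum.inr q') := hne.symm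
        simp only [Φ, if_neg this, Pi.zero_apply, mul_zero]
      · simp [Φ]
    · simp
  rw [Fintype.sum_sum_type, Fintype.sum_sum_type, Fintype.sum_prod_type]
  simp only [W, hr₀, hr₁, zero_mul, Finset.sum_const_zero, add_zero]
  rw [Finset.sum_comm, ← Finset.sum_add_distrib]
  refine Finset.sum_congr rfl fun k _ => ?_
  rw [Finset.sum_mul, ← Finset.sum_add_distrib]
  rw [Finset.sum_eq_single (ν u)]
  · simp
    ring
  · intro n₀ _ hn
    rw [if_neg hn.symm]
    ring
  · simp

/-- The encoder of the second layer: a copy of the channel `one` for each output, a zero channel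
for each output, and a copy of every input channel. -/
noncomputable def rotationEncoder {c' m h d : ℕ}
    (e : ((Fin c' ⊕ Fin c') ⊕ Fin m) ⊕ Fin c' × Fin h ↪ Fin d) (one : Fin m) :
    Matrix (Fin d) (Fin m) ℝ :=
  encoder e fun s j => match s with
    | Sum.inl (Sum.inl (Sum.inl _)) => if j = one then 1 else 0
    | Sum.inl (Sum.inr k) => if j = k then 1 else 0
    | _ => 0

theorem rotationEncoder_mulVec_copy {c' m h d : ℕ}
    (e : ((Fin c' ⊕ Fin c') ⊕ Fin m) ⊕ Fin c' × Fin h ↪ Fin d) (one k : Fin m) (y : Fin m → ℝ) :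
    (rotationEncoder e one *ᵥ y) (e (Sum.inl (Sum.inr k))) = y k := by
  simp [rotationEncoder, encoder_mulVec]

/-- A layer whose bundle maps compute. In the plane spanned by the constant channel of the `j`-th
output and an auxiliary channel, the reflection along `(1, s)` maps `(1, 0)` to a vector with second
coordinate `-2s / (1 + s²)`, where `s` is a network that reads the node and its whole input. -/
theorem exists_rotation_layer {σ : ℝ → ℝ} (hσ : Continuous σ)
    (hpoly : ¬ ∃ p : Polynomial ℝ, ∀ x, σ x = p.eval x) {f c' m h d : ℕ}
    (e : ((Fin c' ⊕ Fin c') ⊕ Fin m) ⊕ Fin c' × Fin h ↪ Fin d) (one : Fin m)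
    (s : Fin c' → (Fin f ⊕ Fin d → ℝ) → ℝ) (hs : ∀ j, s j ∈ neuronSpan σ ⊤)
    (ρ : ℝ) (a w b : Fin h → ℝ) :
    ∃ (L : Layer f d) (dec : Matrix (Fin c') (Fin d) ℝ),
      (∀ p, Continuous fun x => L.bundleMap σ p x) ∧
      ∀ (V : Type*) [Fintype V] [DecidableEq V] (G : SimpleGraph V) [DecidableRel G.Adj] (t : ℝ)
        (P : V → Fin f → ℝ) (Y : V → Fin m → ℝ), (∀ u, Y u one = 1) → ∀ v j,
          (dec *ᵥ L.eval σ G t P (fun u => rotationEncoder e one *ᵥ Y u) v) j =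
            ∑ r, a r * σ (w r * ∑ u, heat G t v u * (ρ *
              (2 * s j (Sum.elim (P u) (rotationEncoder e one *ᵥ Y u)) /
                (1 + s j (Sum.elim (P u) (rotationEncoder e one *ᵥ Y u)) ^ 2))) + b r) := by
  classical
  let T := ((Fin c' ⊕ Fin c') ⊕ Fin m) ⊕ Fin c' × Fin h
  -- The entry `1` keeps the reflection vectors away from `0`, where `householder` is discontinuous.
  let Φ : T → T → (Fin f ⊕ Fin d → ℝ) → ℝ
    | Sum.inl (Sum.inl (Sum.inr j)), Sum.inl (Sum.inl (Sum.inl i)) => if i = j then 1 else 0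
    | Sum.inl (Sum.inl (Sum.inr j)), Sum.inl (Sum.inl (Sum.inr i)) => if i = j then s j else 0
    | _, _ => 0
  -- The sign makes up for the `-2s / (1 + s²)` that the reflection produces.
  let W : T → T → ℝ
    | Sum.inr q, Sum.inl (Sum.inl (Sum.inr j)) => if j = q.1 then -(ρ * w q.2) else 0
    | _, _ => 0
  have hΦmem : ∀ k j, Φ k j ∈ neuronSpan σ ⊤ := by
    rintro (((k | k) | k) | k) (((j | j) | j) | j) <;> simp only [Φ] <;> try split_ifs
    all_goals first
      | exact Submodule.zero_mem _
      | exact hs _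
      | exact const_mem_neuronSpan hpoly 1
  have hdot : ∀ y j (z : T → ℝ), ∑ i, Φ (Sum.inl (Sum.inl (Sum.inr j))) i y * z i =
      z (Sum.inl (Sum.inl (Sum.inl j))) + s j y * z (Sum.inl (Sum.inl (Sum.inr j))) := by
    intro y j z
    simp only [T, Fintype.sum_sum_type, Φ, Pi.zero_apply, zero_mul, Finset.sum_const_zero, add_zero]
    simp [ite_apply]
  have hzero : ∀ k i, (∀ j, k ≠ Sum.inl (Sum.inl (Sum.inr j))) → Φ k i = 0 := by
    rintro (((k | k) | k) | k) i hk
    · simp [Φ]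
    · exact absurd rfl (hk k)
    · simp [Φ]
    · simp [Φ]
  have horth : ∀ y k l, k ≠ l → ∑ j, Φ k j y * Φ l j y = 0 := by
    intro y k l hkl
    by_cases hk : ∃ j, k = Sum.inl (Sum.inl (Sum.inr j))
    · obtain ⟨j, rfl⟩ := hk
      rw [hdot y j fun i => Φ l i y]
      by_cases hl : ∃ j, l = Sum.inl (Sum.inl (Sum.inr j))
      · obtain ⟨i, rfl⟩ := hl
        have : j ≠ i := fun h => hkl (by rw [h])
        simp [Φ, this]
      · rw [hzero l _ (by simpa using hl), hzero l _ (by simpa using hl)]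
        simp
    · simp [hzero k _ (by simpa using hk)]
  obtain ⟨L, -, hLc, hL⟩ := exists_layer hσ e W (Sum.elim 0 fun q => b q.2) Φ hΦmem horth
  refine ⟨L, decoder e fun j => Sum.elim 0 fun q => if q.1 = j then a q.2 else 0, hLc ?_, ?_⟩
  · intro k
    by_cases hk : ∃ j, k = Sum.inl (Sum.inl (Sum.inr j))
    · obtain ⟨j, rfl⟩ := hk
      refine Or.inr fun y => ?_
      rw [hdot y j fun i => Φ _ i y]
      simp only [Φ, if_true, Pi.one_apply]
      nlinarith [mul_self_nonneg (s j y)]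
    · exact Or.inl fun j => hzero k _ (by simpa using hk)
  intro V _ _ G _ t P Y hone v j
  have hfixed : ∀ (q : Fin c' × Fin h) k, Φ k (Sum.inr q) = 0 := by
    rintro q (((k | k) | k) | k) <;> simp [Φ]
  rw [decoder_mulVec, Fintype.sum_sum_type]
  simp only [Sum.elim_inl, Sum.elim_inr, Pi.zero_apply, zero_mul, Finset.sum_const_zero, zero_add,
    Fintype.sum_prod_type]
  rw [Finset.sum_eq_single j _ (by simp)]
  swap
  · intro i _ hij
    simp [hij]
  refine Finset.sum_congr rfl fun r _ => ?_
  rw [hL V G t P _ v (Sum.inr (j, r)) (hfixed _), Sum.elim_inr, if_pos rfl]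
  congr 3
  rw [Finset.mul_sum]
  refine Finset.sum_congr rfl fun u _ => ?_
  set x : Fin d → ℝ := rotationEncoder e one *ᵥ Y u with hx
  have hx₀ : ∀ i, x (e (Sum.inl (Sum.inl (Sum.inl i)))) = 1 := by
    intro i
    rw [hx, rotationEncoder, encoder_mulVec]
    simp [hone]
  have hx₁ : ∀ i, x (e (Sum.inl (Sum.inl (Sum.inr i)))) = 0 := by
    intro i
    rw [hx, rotationEncoder, encoder_mulVec]
    simp
  have hr : reflections (fun k j => Φ k j (Sum.elim (P u) x)) (x ∘ e)
      (Sum.inl (Sum.inl (Sum.inr j))) =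
      -(2 * s j (Sum.elim (P u) x) / (1 + s j (Sum.elim (P u) x) ^ 2)) := by
    rw [reflections, Finset.sum_eq_single (Sum.inl (Sum.inl (Sum.inr j)))]
    · rw [hdot, hdot]
      simp only [Function.comp_apply, hx₀, hx₁, Φ, if_true, Pi.one_apply]
      ring
    · intro k _ hk
      have : Φ k (Sum.inl (Sum.inl (Sum.inr j))) = 0 := by
        rcases k with ((k | k) | k) | k
        · simp [Φ]
        · have : j ≠ k := fun h => hk (by rw [h])
          simp [Φ, this]
        · simp [Φ]
        · simp [Φ]
      simp [this]
    · simp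
  rw [Finset.sum_eq_single (Sum.inl (Sum.inl (Sum.inr j)))]
  · rw [hr]
    simp only [W, if_true]
    ring
  · rintro (((k | k) | k) | k) - hk
    · simp [W]
    · have : k ≠ j := fun h => hk (by rw [h])
      simp [W, this]
    · simp [W]
    · simp [W]
  · simp

/-! ### Networks in one variable that approximate the identity -/

section Scalar

open Filter Topology

/-- Some network in one variable with `h` hidden units differs from the identity by at most `δ` on
`[-M, M]`. -/
def ApproximatesIdentity (σ : ℝ → ℝ) (h : ℕ) (M δ : ℝ) : Prop :=
  ∃ a w b : Fin h → ℝ, ∀ x, |x| ≤ M → |∑ r, a r * σ (w r * x + b r) - x| ≤ δ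

theorem exists_approximatesIdentity {σ : ℝ → ℝ} (hσ : Continuous σ)
    (hpoly : ¬ ∃ p : Polynomial ℝ, ∀ x, σ x = p.eval x) (M : ℝ) {δ : ℝ} (hδ : 0 < δ) :
    ∃ h, ApproximatesIdentity σ h M δ := by
  obtain ⟨g, hg, hgx⟩ := exists_neuronSpan_approx (Λ := ⊤) hσ hpoly
    (fun x : Set.Icc (-M) M => (x : ℝ))
    (fun ℓ _ => ℓ.continuous_of_finiteDimensional.comp continuous_subtype_val)
    (fun x y hxy => ⟨LinearMap.id, trivial, fun h => hxy (Subtype.ext h)⟩)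
    ⟨fun x => (x : ℝ), continuous_subtype_val⟩ hδ
  obtain ⟨h, ℓ, b, a, -, hΦ⟩ := exists_hidden_layer (fun _ : Unit => g) fun _ => hg
  refine ⟨h, a (), fun r => ℓ r 1, b, fun x hx => ?_⟩
  have h1 := hgx ⟨x, abs_le.1 hx⟩
  rw [hΦ ()] at h1
  convert! h1 using 6 with r
  have : ℓ r x = x • ℓ r 1 := by rw [← map_smul, smul_eq_mul, mul_one]
  rw [this, smul_eq_mul, mul_comm]

/-- Where `σ` has a non-zero derivative, a difference quotient is a network with two hidden units
that approximates the identity. -/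
theorem approximatesIdentity_two {σ : ℝ → ℝ} {z : ℝ} (hd : DifferentiableAt ℝ σ z)
    (hz : deriv σ z ≠ 0) (M : ℝ) {δ : ℝ} (hδ : 0 < δ) : ApproximatesIdentity σ 2 M δ := by
  set D := deriv σ z with hD
  let M' := |M| + 1
  have hM' : 0 < M' := by positivity
  have hDpos : 0 < |D| := abs_pos.2 hz
  have ho := (hasDerivAt_iff_isLittleO_nhds_zero.1 hd.hasDerivAt).def
    (show 0 < δ * |D| / M' by positivity)
  obtain ⟨r, hr, hball⟩ := Metric.eventually_nhds_iff.1 ho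
  let η := r / (2 * M')
  have hη : 0 < η := by positivity
  refine ⟨![1 / (η * D), -(1 / (η * D))], ![η, 0], ![z, z], fun x hx => ?_⟩
  have hxM : |x| ≤ M' := by
    have := le_abs_self M
    simp only [M']
    linarith
  have hsmall : dist (η * x) 0 < r := by
    rw [Real.dist_eq, sub_zero, abs_mul, abs_of_pos hη]
    calc η * |x| ≤ η * M' := by gcongr
      _ = r / 2 := by simp only [η]; field_simp
      _ < r := half_lt_self hr
  have h1 := hball hsmall
  simp only [Fin.sum_univ_two, Matrix.cons_val_zero, Matrix.cons_val_one, zero_mul, zero_add]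
  rw [Real.norm_eq_abs, Real.norm_eq_abs, smul_eq_mul, ← hD, abs_mul, abs_of_pos hη] at h1
  have h2 : 1 / (η * D) * σ (η * x + z) + -(1 / (η * D)) * σ z - x =
      (σ (z + η * x) - σ z - η * x * D) / (η * D) := by
    rw [add_comm (η * x) z]
    field_simp
    ring
  rw [h2, abs_div, abs_mul, abs_of_pos hη, div_le_iff₀ (by positivity)]
  calc _ ≤ δ * |D| / M' * (η * |x|) := h1
    _ ≤ δ * |D| / M' * (η * M') := by gcongr
    _ = δ * (η * |D|) := by field_simp

/-- Entrywise application of a function that is close to the identity changes a continuous map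
little, uniformly on a compact set. -/
theorem eventually_dist_comp_le {V Q E : Type*} [Fintype V] [Fintype Q] [PseudoMetricSpace E]
    {𝒞 : Set (V → Q → ℝ)} (h𝒞 : IsCompact 𝒞) {Φ : (V → Q → ℝ) → E} (hΦ : Continuous Φ)
    {ε : ℝ} (hε : 0 < ε) : ∀ᶠ n : ℕ in atTop, ∀ g : ℝ → ℝ,
      (∀ x : ℝ, |x| ≤ n → |g x - x| ≤ 1 / (n + 1)) → ∀ y ∈ 𝒞,
        dist (Φ fun v q => g (y v q)) (Φ y) ≤ ε := by
  obtain ⟨M, hM⟩ := h𝒞.isBounded.exists_norm_le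
  have hunif := h𝒞.uniformContinuousAt_of_continuousAt Φ (fun _ _ => hΦ.continuousAt)
    (Metric.dist_mem_uniformity hε)
  obtain ⟨δ, hδ, hδ'⟩ := Metric.mem_uniformity_dist.1 hunif
  have hlim := (tendsto_one_div_add_atTop_nhds_zero_nat (𝕜 := ℝ)).eventually (gt_mem_nhds hδ)
  filter_upwards [hlim, eventually_ge_atTop ⌈M⌉₊] with n hn hnM g hg y hy
  have hclose : dist y (fun v q => g (y v q)) < δ := by
    refine lt_of_le_of_lt ((dist_pi_le_iff (by positivity)).2 fun v =>
      (dist_pi_le_iff (by positivity)).2 fun q => ?_) hn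
    rw [dist_comm, Real.dist_eq]
    refine hg _ ?_
    calc |y v q| ≤ ‖y v‖ := norm_le_pi_norm (y v) q
      _ ≤ ‖y‖ := norm_le_pi_norm y v
      _ ≤ M := hM y hy
      _ ≤ ⌈M⌉₊ := Nat.le_ceil M
      _ ≤ n := by exact_mod_cast hnM
  have := hδ' hclose hy
  rw [dist_comm]
  exact le_of_lt this

/-- A continuous right inverse of `s ↦ 2s / (1 + s²)` on `[-1, 1]`. -/
noncomputable def halfSlope (y : ℝ) : ℝ := y / (1 + √(1 - y ^ 2))

theorem continuous_halfSlope : Continuous halfSlope := by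
  unfold halfSlope
  refine continuous_id.div (by fun_prop) fun y => ?_
  positivity

theorem two_mul_halfSlope_div {y : ℝ} (hy : |y| ≤ 1) :
    2 * halfSlope y / (1 + halfSlope y ^ 2) = y := by
  have h0 : 0 ≤ 1 - y ^ 2 := by
    have := (sq_le_one_iff_abs_le_one y).2 hy
    linarith
  have h1 := Real.sq_sqrt h0
  have h2 := Real.sqrt_nonneg (1 - y ^ 2)
  unfold halfSlope
  set r := √(1 - y ^ 2)
  have h3 : 0 < 1 + r := by linarith
  have h4 : 1 + (y / (1 + r)) ^ 2 = 2 / (1 + r) := by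
    field_simp
    nlinarith
  rw [h4]
  field_simp

theorem abs_two_mul_div_le (s : ℝ) : |2 * s / (1 + s ^ 2)| ≤ 1 := by
  have h : 0 < 1 + s ^ 2 := by positivity
  rw [abs_div, abs_of_pos h, div_le_one h, abs_le]
  constructor <;> nlinarith [sq_nonneg (s - 1), sq_nonneg (s + 1)]

theorem abs_two_mul_div_sub_le (s s' : ℝ) :
    |2 * s / (1 + s ^ 2) - 2 * s' / (1 + s' ^ 2)| ≤ 2 * |s - s'| := by
  have h : 0 < 1 + s ^ 2 := by positivity
  have h' : 0 < 1 + s' ^ 2 := by positivity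
  have h1 : 2 * s / (1 + s ^ 2) - 2 * s' / (1 + s' ^ 2) =
      2 * (s - s') * ((1 - s * s') / ((1 + s ^ 2) * (1 + s' ^ 2))) := by
    field_simp
    ring
  have h2 : |(1 - s * s') / ((1 + s ^ 2) * (1 + s' ^ 2))| ≤ 1 := by
    rw [abs_div, abs_of_pos (mul_pos h h'), div_le_one (mul_pos h h'), abs_le]
    constructor <;> nlinarith [sq_nonneg (s - s'), sq_nonneg (s + s'), sq_nonneg (s * s')]
  rw [h1, abs_mul, abs_mul, abs_two]
  exact mul_le_of_le_one_right (by positivity) h2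

end Scalar

/-! ### Broadcasting the signals of all nodes -/

section Broadcast

variable {V N : Type*} [Fintype V] {c : ℕ}

open Classical in
/-- The signal in which each node `v` holds, for every label `n`, the signal of the node with
label `n`, weighted by the heat kernel; it is zero if the graph has no node with that label. -/
noncomputable def broadcast (κ : Matrix V V ℝ) (ν : V → N) (X : V → Fin c → ℝ) (v : V)
    (q : N × Fin c) : ℝ :=
  ∑ u, κ v u * if ν u = q.1 then X u q.2 else 0

open Classical in
/-- The diffusion of the signal from which each node `u` keeps the channels of its own label and
to which it adds an indicator of that label. -/
noncomputable def collect (κ : Matrix V V ℝ) (ν : V → N) (y : V → N × Fin c → ℝ) (v : V) :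
    N × Fin c ⊕ N → ℝ :=
  Sum.elim (fun q => ∑ u, κ v u * if ν u = q.1 then y u q else 0)
    fun n => ∑ u, κ v u * if ν u = n then 1 else 0

theorem sum_mul_ite_label (κ : Matrix V V ℝ) {ν : V → N} (hν : Function.Injective ν) (z : V → ℝ)
    (v u : V) [∀ w, Decidable (ν w = ν u)] :
    ∑ w, κ v w * (if ν w = ν u then z w else 0) = κ v u * z u := by
  rw [Finset.sum_eq_single u]
  · simp
  · intro w _ hw
    rw [if_neg fun h => hw (hν h), mul_zero]
  · simp

theorem broadcast_apply (κ : Matrix V V ℝ) {ν : V → N} (hν : Function.Injective ν)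
    (X : V → Fin c → ℝ) (v u : V) (k : Fin c) :
    broadcast κ ν X v (ν u, k) = κ v u * X u k :=
  open Classical in sum_mul_ite_label κ hν (fun w => X w k) v u

theorem collect_apply_inl (κ : Matrix V V ℝ) {ν : V → N} (hν : Function.Injective ν)
    (y : V → N × Fin c → ℝ) (v u : V) (k : Fin c) :
    collect κ ν y v (Sum.inl (ν u, k)) = κ v u * y u (ν u, k) :=
  open Classical in sum_mul_ite_label κ hν (fun w => y w (ν u, k)) v u

theorem collect_apply_inr (κ : Matrix V V ℝ) {ν : V → N} (hν : Function.Injective ν)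
    (y : V → N × Fin c → ℝ) (v u : V) : collect κ ν y v (Sum.inr (ν u)) = κ v u := by
  have := open Classical in sum_mul_ite_label κ hν (fun _ => 1) v u
  rwa [mul_one] at this

theorem collect_apply_inr_eq_zero (κ : Matrix V V ℝ) {ν : V → N} (y : V → N × Fin c → ℝ) (v : V)
    {n : N} (h : ∀ u, ν u ≠ n) : collect κ ν y v (Sum.inr n) = 0 :=
  Finset.sum_eq_zero fun u _ => by rw [if_neg (h u), mul_zero]

theorem continuous_broadcast (κ : Matrix V V ℝ) (ν : V → N) :
    Continuous fun X : V → Fin c → ℝ => broadcast κ ν X := by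
  refine continuous_pi fun v => continuous_pi fun q => ?_
  unfold broadcast
  refine continuous_finsetSum _ fun u _ => continuous_const.mul ?_
  split_ifs
  · fun_prop
  · exact continuous_const

theorem continuous_collect (κ : Matrix V V ℝ) (ν : V → N) (v : V) :
    Continuous fun y : V → N × Fin c → ℝ => collect κ ν y v := by
  refine continuous_pi fun q => ?_
  rcases q with q | n
  · classical
    change Continuous fun y : V → N × Fin c → ℝ => ∑ u, κ v u * if ν u = q.1 then y u q else 0
    refine continuous_finsetSum _ fun u _ => continuous_const.mul ?_
    split_ifs
    · fun_prop
    · exact continuous_const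
  · exact continuous_const

/-- A broadcast signal together with the constant channel, as a vector. -/
def withOne {Q : Type*} {m : ℕ} (em : Q ⊕ Unit ≃ Fin m) (y : Q → ℝ) : Fin m → ℝ :=
  fun i => Sum.elim y (fun _ => 1) (em.symm i)

/-- A positional layer that broadcasts all signals, up to a network in one variable, together with
a channel that is constantly one. -/
theorem exists_broadcast_layer {σ : ℝ → ℝ} (hσ : Continuous σ)
    (hpoly : ¬ ∃ p : Polynomial ℝ, ∀ x, σ x = p.eval x) {N : Type*} [Fintype N] {f c d m h : ℕ}
    (e : (Fin c ⊕ N × Fin c) ⊕ ((N × Fin c) × Fin h ⊕ Unit) ↪ Fin d)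
    (em : N × Fin c ⊕ Unit ≃ Fin m) (π : N → Fin f → ℝ) (hπ : Function.Injective π)
    (a w b : Fin h → ℝ) :
    ∃ (L : Layer f d) (enc : Matrix (Fin d) (Fin c) ℝ) (dec : Matrix (Fin m) (Fin d) ℝ),
      L.IsPositional ∧ ∀ (V : Type*) [Fintype V] [DecidableEq V] (G : SimpleGraph V)
        [DecidableRel G.Adj] (t : ℝ) (ν : V → N) (P : V → Fin f → ℝ), (∀ v, P v = π (ν v)) →
        ∀ (X : V → Fin c → ℝ) (v : V), dec *ᵥ L.eval σ G t P (fun u => enc *ᵥ X u) v =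
          withOne em fun q => ∑ r, a r * σ (w r * broadcast (heat G t) ν X v q + b r) := by
  classical
  obtain ⟨z, hz⟩ := exists_ne_zero_of_not_polynomial hpoly
  obtain ⟨L, enc, dec, hL, h⟩ := exists_gather_layer hσ hpoly e π hπ
    (Sum.elim (fun q n k => if n = q.1.1 ∧ k = q.1.2 then w q.2 else 0) 0)
    (Sum.elim (fun q => b q.2) fun _ => z)
    (fun μ => Sum.elim (fun q => if em.symm μ = Sum.inl q.1 then a q.2 else 0)
      fun _ => if em.symm μ = Sum.inr () then (σ z)⁻¹ else 0)
  refine ⟨L, enc, dec, hL, fun V _ _ G _ t ν P hP X v => ?_⟩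
  ext μ
  rw [h V G t ν P hP X v μ, withOne]
  rw [Fintype.sum_sum_type, Fintype.sum_prod_type]
  rcases em.symm μ with q | _
  · simp only [Sum.elim_inl, Sum.elim_inr, reduceCtorEq, if_false, zero_mul,
      Finset.sum_const_zero, add_zero]
    rw [Finset.sum_eq_single q _ (by simp)]
    · refine Finset.sum_congr rfl fun r _ => ?_
      rw [if_pos rfl]
      congr 3
      rw [broadcast, Finset.mul_sum]
      refine Finset.sum_congr rfl fun u _ => ?_
      by_cases hu : ν u = q.1
      · simp [hu]
        ring
      · simp [hu]
    · intro q' _ hq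
      simp [hq.symm]
  · simp [hz]

end Broadcast

/-! ### Universality -/

section Universality

open Filter Topology

theorem dual_apply_eq_sum {α : Type*} [Fintype α] [DecidableEq α] (ℓ : Module.Dual ℝ (α → ℝ))
    (x : α → ℝ) : ℓ x = ∑ q, ℓ (Pi.single q 1) * x q := by
  conv_lhs => rw [← Finset.univ_sum_single x]
  rw [map_sum]
  refine Finset.sum_congr rfl fun q _ => ?_
  have : (Pi.single q (x q) : α → ℝ) = x q • Pi.single q 1 := by
    rw [← Pi.single_smul, smul_eq_mul, mul_one]
  rw [this, map_smul, smul_eq_mul, mul_comm]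

open Classical in
/-- The weights with which a gather layer computes a functional of the collected features. -/
noncomputable def collectWeight {N : Type*} [Fintype N] {c m : ℕ} (em : N × Fin c ⊕ Unit ≃ Fin m)
    (ℓ : Module.Dual ℝ (N × Fin c ⊕ N → ℝ)) (n : N) (i : Fin m) : ℝ :=
  Sum.elim (fun q => if q.1 = n then ℓ (Pi.single (Sum.inl q) 1) else 0)
    (fun _ => ℓ (Pi.single (Sum.inr n) 1)) (em.symm i)

theorem sum_collectWeight {V N : Type*} [Fintype V] [Fintype N] {c m : ℕ}
    (em : N × Fin c ⊕ Unit ≃ Fin m) (ℓ : Module.Dual ℝ (N × Fin c ⊕ N → ℝ)) (κ : Matrix V V ℝ)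
    (ν : V → N) (y : V → N × Fin c → ℝ) (v : V) :
    ∑ u, κ v u * ∑ i, collectWeight em ℓ (ν u) i * withOne em (y u) i =
      ℓ (collect κ ν y v) := by
  classical
  have hin : ∀ u, ∑ i, collectWeight em ℓ (ν u) i * withOne em (y u) i =
      (∑ q : N × Fin c, if ν u = q.1 then ℓ (Pi.single (Sum.inl q) 1) * y u q else 0) +
        ∑ n, if ν u = n then ℓ (Pi.single (Sum.inr n) 1) else 0 := by
    intro u
    rw [← em.sum_comp, Fintype.sum_sum_type]
    simp only [collectWeight, withOne, Equiv.symm_apply_apply, Sum.elim_inl, Sum.elim_inr]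
    congr 1
    · refine Finset.sum_congr rfl fun q _ => ?_
      by_cases h : ν u = q.1
      · simp [h]
      · simp [h, Ne.symm h]
    · simp
  rw [dual_apply_eq_sum, Fintype.sum_sum_type]
  simp only [hin, collect, Sum.elim_inl, Sum.elim_inr, mul_add, Finset.sum_add_distrib,
    Finset.mul_sum]
  congr 1
  · rw [Finset.sum_comm]
    refine Finset.sum_congr rfl fun q _ => Finset.sum_congr rfl fun u _ => ?_
    by_cases h : ν u = q.1
    · simp only [h, if_true]
      ring
    · simp [h]
  · rw [Finset.sum_comm]
    refine Finset.sum_congr rfl fun q _ => Finset.sum_congr rfl fun u _ => ?_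
    by_cases h : ν u = q
    · simp only [h, if_true]
      ring
    · simp [h]

variable {I : Type*} {U : I → Type*} {c : ℕ}

/-- The disjoint union, over all nodes of a family of graphs, of the spaces of signals with values
in `K` on the graph of the node. -/
abbrev PointedSignal (U : I → Type*) (K : Set (Fin c → ℝ)) :=
  Σ n : (Σ i, U i), {X : U n.1 → Fin c → ℝ // ∀ v, X v ∈ K}

theorem isCompact_signals {K : Set (Fin c → ℝ)} (hK : IsCompact K) (V : Type*) :
    IsCompact {X : V → Fin c → ℝ | ∀ v, X v ∈ K} := by
  convert! isCompact_univ_pi fun _ : V => hK using 1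
  ext X
  simp

theorem compactSpace_pointedSignal [Fintype I] [∀ i, Fintype (U i)] {K : Set (Fin c → ℝ)}
    (hK : IsCompact K) : CompactSpace (PointedSignal U K) := by
  have : ∀ n : (Σ i, U i), CompactSpace {X : U n.1 → Fin c → ℝ // ∀ v, X v ∈ K} := fun n =>
    isCompact_iff_compactSpace.1 (isCompact_signals hK (U n.1))
  infer_instance

variable [∀ i, Fintype (U i)] [∀ i, DecidableEq (U i)] (G : ∀ i, SimpleGraph (U i))
  [∀ i, DecidableRel (G i).Adj]

/-- The collected features determine the node and the signal: the indicator channels hold a row of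
the heat kernel, which is invertible and positive. -/
theorem collect_broadcast_injective (hG : ∀ i, (G i).Connected) {t : ℝ} (ht : 0 < t)
    (K : Set (Fin c → ℝ)) : Function.Injective fun ω : PointedSignal U K =>
      collect (heat (G ω.1.1) t) (Sigma.mk ω.1.1)
        (broadcast (heat (G ω.1.1) t) (Sigma.mk ω.1.1) ω.2.1) ω.1.2 := by
  rintro ⟨⟨i, v⟩, X⟩ ⟨⟨j, w⟩, X'⟩ h
  simp only at h
  have hinj : ∀ i, Function.Injective (Sigma.mk i : U i → Σ i, U i) := fun i => sigma_mk_injective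
  have hij : i = j := by
    by_contra hij
    have h1 := congrFun h (Sum.inr ⟨i, v⟩)
    rw [collect_apply_inr _ (hinj i), collect_apply_inr_eq_zero] at h1
    · exact (heat_pos (G i) (hG i) ht v v).ne' h1
    · intro u hu
      exact hij (congrArg Sigma.fst hu).symm
  subst hij
  have hvw : v = w := by
    refine heat_row_injective (G i) t (funext fun u => ?_)
    have h1 := congrFun h (Sum.inr ⟨i, u⟩)
    rwa [collect_apply_inr _ (hinj i), collect_apply_inr _ (hinj i)] at h1
  subst hvw
  have hX : X = X' := by
    refine Subtype.ext (funext fun u => funext fun k => ?_)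
    have h1 := congrFun h (Sum.inl (⟨i, u⟩, k))
    rw [collect_apply_inl _ (hinj i), collect_apply_inl _ (hinj i), broadcast_apply _ (hinj i),
      broadcast_apply _ (hinj i)] at h1
    have hp := heat_pos (G i) (hG i) ht
    exact mul_left_cancel₀ (hp u u).ne' (mul_left_cancel₀ (hp v u).ne' h1)
  rw [hX]

/-- The universality of positional networks on a finite family of graphs. The first layer
broadcasts the signals, the second collects them into features that determine the pointed signal,
and its activation is the hidden layer of a network in these features. -/
theorem exists_positional_approx [Fintype I] {σ : ℝ → ℝ} (hσ : Continuous σ)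
    (hpoly : ¬ ∃ p : Polynomial ℝ, ∀ x, σ x = p.eval x) {t : ℝ} (ht : 0 < t)
    (hG : ∀ i, (G i).Connected) {f c' : ℕ} (P : ∀ i, U i → Fin f → ℝ) (hP : InjectiveEncoding P)
    (H : FeatureTransformation U c c') {K : Set (Fin c → ℝ)} (hK : IsCompact K) {ε : ℝ}
    (hε : 0 < ε) : ∃ (d m : ℕ) (B : BuNN₂ f c c' d m), B.IsPositional ∧
      ∀ i X, (∀ v, X v ∈ K) → ‖B.eval σ (G i) t (P i) X - H i X‖ ≤ ε := by
  classical
  have := compactSpace_pointedSignal (U := U) hK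
  have hcollect : Continuous fun ω : PointedSignal U K =>
      collect (heat (G ω.1.1) t) (Sigma.mk ω.1.1)
        (broadcast (heat (G ω.1.1) t) (Sigma.mk ω.1.1) ω.2.1) ω.1.2 :=
    continuous_sigma fun n => (continuous_collect (heat (G n.1) t) (Sigma.mk n.1) n.2).comp
      ((continuous_broadcast (heat (G n.1) t) (Sigma.mk n.1)).comp continuous_subtype_val)
  have htarget : ∀ j, Continuous fun ω : PointedSignal U K => H ω.1.1 ω.2.1 ω.1.2 j := fun j =>
    continuous_sigma fun n => (continuous_apply_apply n.2 j).comp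
      ((H n.1).continuous.comp continuous_subtype_val)
  choose g hg hgT using fun j : Fin c' => exists_neuronSpan_approx (Λ := ⊤) hσ hpoly
    (fun ω : PointedSignal U K => collect (heat (G ω.1.1) t) (Sigma.mk ω.1.1)
      (broadcast (heat (G ω.1.1) t) (Sigma.mk ω.1.1) ω.2.1) ω.1.2)
    (fun ℓ _ => ℓ.continuous_of_finiteDimensional.comp hcollect)
    (fun x y hxy => by
      obtain ⟨q, hq⟩ := Function.ne_iff.1 ((collect_broadcast_injective G hG ht K).ne hxy)
      exact ⟨LinearMap.proj q, trivial, hq⟩)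
    ⟨_, htarget j⟩ (half_pos hε)
  obtain ⟨h₂, ℓ, b₂, a₂, -, hΦ⟩ := exists_hidden_layer g hg
  let Φ : ∀ i, (U i → (Σ i, U i) × Fin c → ℝ) → U i → Fin c' → ℝ := fun i y v j =>
    g j (collect (heat (G i) t) (Sigma.mk i) y v)
  have hΦc : ∀ i, Continuous (Φ i) := fun i => continuous_pi fun v => continuous_pi fun j =>
    (continuous_of_mem_neuronSpan hσ (hg j)).comp (continuous_collect _ _ _)
  obtain ⟨n, hn⟩ := (eventually_all.2 fun i => eventually_dist_comp_le
    ((isCompact_signals hK (U i)).image (continuous_broadcast (heat (G i) t) (Sigma.mk i)))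
    (hΦc i) (half_pos hε)).exists
  obtain ⟨h₁, a₁, w₁, b₁, hid⟩ := exists_approximatesIdentity hσ hpoly n
    (show (0 : ℝ) < 1 / (n + 1) by positivity)
  let em := Fintype.equivFin ((Σ i, U i) × Fin c ⊕ Unit)
  let T₁ := (Fin c ⊕ (Σ i, U i) × Fin c) ⊕ (((Σ i, U i) × Fin c) × Fin h₁ ⊕ Unit)
  let T₂ := (Fin (Fintype.card ((Σ i, U i) × Fin c ⊕ Unit)) ⊕
    (Σ i, U i) × Fin (Fintype.card ((Σ i, U i) × Fin c ⊕ Unit))) ⊕ Fin h₂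
  let eT := Fintype.equivFin (T₁ ⊕ T₂)
  obtain ⟨L₁, enc₁, dec₁, hL₁, heval₁⟩ := exists_broadcast_layer hσ hpoly
    ((Function.Embedding.inl : T₁ ↪ T₁ ⊕ T₂).trans eT.toEmbedding) em
    (fun n : Σ i, U i => P n.1 n.2) hP a₁ w₁ b₁
  obtain ⟨L₂, enc₂, dec₂, hL₂, heval₂⟩ := exists_gather_layer hσ hpoly
    ((Function.Embedding.inr : T₂ ↪ T₁ ⊕ T₂).trans eT.toEmbedding)
    (fun n : Σ i, U i => P n.1 n.2) hP (fun r => collectWeight em (ℓ r)) b₂ a₂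
  refine ⟨_, _, ⟨enc₁, L₁, dec₁, enc₂, L₂, dec₂⟩, ⟨hL₁, hL₂⟩, fun i X hX => ?_⟩
  let y : U i → (Σ i, U i) × Fin c → ℝ := broadcast (heat (G i) t) (Sigma.mk i) X
  let γ : ℝ → ℝ := fun x => ∑ r, a₁ r * σ (w₁ r * x + b₁ r)
  have heval : BuNN₂.eval ⟨enc₁, L₁, dec₁, enc₂, L₂, dec₂⟩ σ (G i) t (P i) X =
      Φ i fun v q => γ (y v q) := by
    funext v j
    simp only [BuNN₂.eval]
    have hY : (fun u => enc₂ *ᵥ (dec₁ *ᵥ L₁.eval σ (G i) t (P i) (fun u => enc₁ *ᵥ X u) u)) =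
        fun u => enc₂ *ᵥ withOne em fun q => γ (y u q) := by
      funext u
      rw [heval₁ (U i) (G i) t (Sigma.mk i) (P i) (fun _ => rfl) X u]
    rw [hY, heval₂ (U i) (G i) t (Sigma.mk i) (P i) (fun _ => rfl)]
    simp only [Φ, hΦ, sum_collectWeight]
  rw [heval, ← dist_eq_norm]
  have h1 := hn i γ hid y ⟨X, hX, rfl⟩
  have h2 : dist (Φ i y) (H i X) ≤ ε / 2 := by
    refine (dist_pi_le_iff (half_pos hε).le).2 fun v => (dist_pi_le_iff (half_pos hε).le).2
      fun j => ?_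
    rw [Real.dist_eq]
    exact hgT j ⟨⟨i, v⟩, X, hX⟩
  linarith [dist_triangle (Φ i fun v q => γ (y v q)) (Φ i y) (H i X)]

/-- The universality of narrow networks on a finite family of graphs. The second layer computes
`κ⁻¹ H` at each node by means of its bundle maps, where `κ` is the heat kernel, so that diffusion
turns the result into `H`. -/
theorem exists_narrow_approx [Fintype I] [Nonempty (Σ i, U i)] {σ : ℝ → ℝ} (hσ : Continuous σ)
    (hpoly : ¬ ∃ p : Polynomial ℝ, ∀ x, σ x = p.eval x)
    (hderiv : ∃ z, DifferentiableAt ℝ σ z ∧ deriv σ z ≠ 0) {t : ℝ} (ht : 0 < t)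
    (hG : ∀ i, (G i).Connected) {f c' : ℕ} (P : ∀ i, U i → Fin f → ℝ) (hP : InjectiveEncoding P)
    (H : FeatureTransformation U c c') {K : Set (Fin c → ℝ)} (hK : IsCompact K) {ε : ℝ}
    (hε : 0 < ε) : ∃ d m : ℕ, d ≤ (5 * c + 4 * c' + 2) * ∑ i, Fintype.card (U i) ∧
      m ≤ (5 * c + 4 * c' + 2) * ∑ i, Fintype.card (U i) ∧ ∃ B : BuNN₂ f c c' d m,
        (∀ p, Continuous fun x => B.layer₁.bundleMap σ p x) ∧
        (∀ p, Continuous fun x => B.layer₂.bundleMap σ p x) ∧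
        ∀ i X, (∀ v, X v ∈ K) → ‖B.eval σ (G i) t (P i) X - H i X‖ ≤ ε := by
  classical
  obtain ⟨z, hz, hz'⟩ := hderiv
  have := compactSpace_pointedSignal (U := U) hK
  let N := Σ i, U i
  let em := Fintype.equivFin (N × Fin c ⊕ Unit)
  let m := Fintype.card (N × Fin c ⊕ Unit)
  let T₁ := (Fin c ⊕ N × Fin c) ⊕ ((N × Fin c) × Fin 2 ⊕ Unit)
  let T₂ := ((Fin c' ⊕ Fin c') ⊕ Fin m) ⊕ Fin c' × Fin 2
  let eT := Fintype.equivFin (T₁ ⊕ T₂)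
  let d := Fintype.card (T₁ ⊕ T₂)
  let e₁ : T₁ ↪ Fin d := Function.Embedding.inl.trans eT.toEmbedding
  let e₂ : T₂ ↪ Fin d := Function.Embedding.inr.trans eT.toEmbedding
  let enc₂ : Matrix (Fin d) (Fin m) ℝ := rotationEncoder e₂ (em (Sum.inr ()))
  let κ : ∀ i, Matrix (U i) (U i) ℝ := fun i => heat (G i) t
  -- What the perceptron of the second layer reads at node `u`, given the broadcast signal.
  let read : ∀ i, (U i → N × Fin c → ℝ) → U i → Fin f ⊕ Fin d → ℝ := fun i y u =>
    Sum.elim (P i u) (enc₂ *ᵥ withOne em (y u))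
  have hread : ∀ i u, Continuous fun y => read i y u := by
    intro i u
    refine continuous_pi fun q => ?_
    rcases q with q | q
    · exact continuous_const
    · refine (continuous_apply q).comp (f := fun y : U i → N × Fin c → ℝ =>
        enc₂ *ᵥ withOne em (y u)) (continuous_const.matrix_mulVec (continuous_pi fun k => ?_))
      unfold withOne
      rcases em.symm k with q' | _
      · exact continuous_apply_apply u q'
      · exact continuous_const
  have hinj : ∀ i, Function.Injective (Sigma.mk i : U i → Σ i, U i) := fun i => sigma_mk_injective
  have hcopy : ∀ (y : N × Fin c → ℝ) q,
      (enc₂ *ᵥ withOne em y) (e₂ (Sum.inl (Sum.inr (em (Sum.inl q))))) = y q := by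
    intro y q
    refine (rotationEncoder_mulVec_copy e₂ _ _ _).trans ?_
    simp [withOne]
  have hreadinj : Function.Injective fun ω : PointedSignal U K =>
      read ω.1.1 (broadcast (κ ω.1.1) (Sigma.mk ω.1.1) ω.2.1) ω.1.2 := by
    rintro ⟨n, X⟩ ⟨n', X'⟩ h
    have hn : n = n' := hP (funext fun q => congrFun h (Sum.inl q))
    subst hn
    obtain ⟨i, v⟩ := n
    have hX : X = X' := by
      refine Subtype.ext (funext fun u => funext fun k => ?_)
      have h1 := (hcopy _ (⟨i, u⟩, k)).symm.trans ((congrFun h (Sum.inr (e₂ (Sum.inl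
        (Sum.inr (em (Sum.inl (⟨i, u⟩, k)))))))).trans (hcopy _ (⟨i, u⟩, k)))
      rw [broadcast_apply _ (hinj i), broadcast_apply _ (hinj i)] at h1
      exact mul_left_cancel₀ (heat_pos (G i) (hG i) ht v u).ne' h1
    rw [hX]
  have hreadc : Continuous fun ω : PointedSignal U K =>
      read ω.1.1 (broadcast (κ ω.1.1) (Sigma.mk ω.1.1) ω.2.1) ω.1.2 :=
    continuous_sigma fun n => (hread n.1 n.2).comp
      ((continuous_broadcast (κ n.1) (Sigma.mk n.1)).comp continuous_subtype_val)
  have htarget : ∀ j, Continuous fun ω : PointedSignal U K =>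
      ∑ w, (κ ω.1.1)⁻¹ ω.1.2 w * H ω.1.1 ω.2.1 w j := by
    refine fun j => continuous_sigma fun n => ?_
    have hH : ∀ w, Continuous fun X : {X : U n.1 → Fin c → ℝ // ∀ v, X v ∈ K} => H n.1 X.1 w j :=
      fun w => (continuous_apply_apply w j).comp
        ((H n.1).continuous.comp continuous_subtype_val)
    have hsum : Continuous fun X : {X : U n.1 → Fin c → ℝ // ∀ v, X v ∈ K} =>
        ∑ w, (κ n.1)⁻¹ n.2 w * H n.1 X.1 w j :=
      continuous_finsetSum _ fun w _ => continuous_const.mul (hH w)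
    exact hsum
  let τ : Fin c' → C(PointedSignal U K, ℝ) := fun j => ⟨_, htarget j⟩
  let M : ℝ := ∑ j, ‖τ j‖ + 1
  have hM : 0 < M := add_pos_of_nonneg_of_pos (Finset.sum_nonneg fun j _ => norm_nonneg _) one_pos
  have hτM : ∀ j ω, |τ j ω / M| ≤ 1 := by
    intro j ω
    rw [abs_div, abs_of_pos hM, div_le_one hM]
    have h1 : ‖τ j ω‖ ≤ ‖τ j‖ := (τ j).norm_coe_le_norm ω
    have h2 := Finset.single_le_sum (f := fun j => ‖τ j‖) (fun j _ => norm_nonneg _)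
      (Finset.mem_univ j)
    rw [Real.norm_eq_abs] at h1
    simp only [M]
    linarith
  -- The error `ε / 3` for `M q(s)`, where `q(s) = 2s / (1 + s²)` is Lipschitz with constant `2`.
  choose s hs hsτ using fun j : Fin c' => exists_neuronSpan_approx (Λ := ⊤) hσ hpoly
    (fun ω : PointedSignal U K => read ω.1.1 (broadcast (κ ω.1.1) (Sigma.mk ω.1.1) ω.2.1) ω.1.2)
    (fun ℓ _ => ℓ.continuous_of_finiteDimensional.comp hreadc)
    (fun x y hxy => by
      obtain ⟨q, hq⟩ := Function.ne_iff.1 (hreadinj.ne hxy)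
      exact ⟨LinearMap.proj q, trivial, hq⟩)
    ⟨fun ω => halfSlope (τ j ω / M), continuous_halfSlope.comp ((τ j).continuous.div_const M)⟩
    (show 0 < ε / (6 * M) by positivity)
  let Φ : ∀ i, (U i → N × Fin c → ℝ) → U i → Fin c' → ℝ := fun i y v j =>
    ∑ u, κ i v u * (M * (2 * s j (read i y u) / (1 + s j (read i y u) ^ 2)))
  have hΦc : ∀ i, Continuous (Φ i) := by
    refine fun i => continuous_pi fun v => continuous_pi fun j => ?_
    refine continuous_finsetSum _ fun u _ => ?_
    have hsc := (continuous_of_mem_neuronSpan hσ (hs j)).comp (hread i u)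
    refine continuous_const.mul (continuous_const.mul (Continuous.div ?_ ?_ fun y => ?_))
    · exact continuous_const.mul hsc
    · exact continuous_const.add (hsc.pow 2)
    · positivity
  have hκ : ∀ i v u, 0 ≤ κ i v u := fun i v u => (heat_pos (G i) (hG i) ht v u).le
  have hΦM : ∀ i y v j, |Φ i y v j| ≤ M := by
    intro i y v j
    calc |Φ i y v j| ≤ ∑ u, κ i v u * M := by
          refine (Finset.abs_sum_le_sum_abs _ _).trans (Finset.sum_le_sum fun u _ => ?_)
          rw [abs_mul, abs_mul, abs_of_nonneg (hκ i v u), abs_of_pos hM]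
          exact mul_le_mul_of_nonneg_left
            (mul_le_of_le_one_right hM.le (abs_two_mul_div_le _)) (hκ i v u)
      _ = M := by rw [← Finset.sum_mul, heat_sum, one_mul]
  -- Two more errors of `ε / 3` come from the approximate identities after the two layers.
  have hε3 : 0 < ε / 3 := by positivity
  obtain ⟨n, hn⟩ := (eventually_all.2 fun i => eventually_dist_comp_le
    ((isCompact_signals hK (U i)).image (continuous_broadcast (κ i) (Sigma.mk i)))
    (hΦc i) hε3).exists
  obtain ⟨a₁, w₁, b₁, hid₁⟩ := approximatesIdentity_two hz hz' n
    (show (0 : ℝ) < 1 / (n + 1) by positivity)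
  obtain ⟨a₂, w₂, b₂, hid₂⟩ := approximatesIdentity_two hz hz' M hε3
  obtain ⟨L₁, enc₁, dec₁, hL₁, heval₁⟩ := exists_broadcast_layer hσ hpoly e₁ em
    (fun n : N => P n.1 n.2) hP a₁ w₁ b₁
  obtain ⟨L₂, dec₂, hL₂, heval₂⟩ := exists_rotation_layer hσ hpoly e₂ (em (Sum.inr ())) s hs M
    a₂ w₂ b₂
  have hcard : Fintype.card N = ∑ i, Fintype.card (U i) := Fintype.card_sigma
  have hpos : 1 ≤ Fintype.card N := Fintype.card_pos
  refine ⟨d, m, ?_, ?_, ⟨enc₁, L₁, dec₁, enc₂, L₂, dec₂⟩,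
    fun p => continuous_bundleMap_of_isPositional L₁ σ hL₁ p, hL₂, fun i X hX => ?_⟩
  · simp only [d, T₁, T₂, m, Fintype.card_sum, Fintype.card_prod, Fintype.card_fin,
      Fintype.card_unit, ← hcard]
    nlinarith [Nat.mul_le_mul_left c hpos, Nat.mul_le_mul_left c' hpos]
  · simp only [m, Fintype.card_sum, Fintype.card_prod, Fintype.card_fin, Fintype.card_unit,
      ← hcard]
    nlinarith [Nat.mul_le_mul_left c hpos, Nat.mul_le_mul_left c' hpos]
  let y : U i → N × Fin c → ℝ := broadcast (κ i) (Sigma.mk i) X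
  let γ : ℝ → ℝ := fun x => ∑ r, a₁ r * σ (w₁ r * x + b₁ r)
  have heval : ∀ v j, BuNN₂.eval ⟨enc₁, L₁, dec₁, enc₂, L₂, dec₂⟩ σ (G i) t (P i) X v j =
      ∑ r, a₂ r * σ (w₂ r * Φ i (fun v q => γ (y v q)) v j + b₂ r) := by
    intro v j
    simp only [BuNN₂.eval]
    have hY : (fun u => enc₂ *ᵥ (dec₁ *ᵥ L₁.eval σ (G i) t (P i) (fun u => enc₁ *ᵥ X u) u)) =
        fun u => enc₂ *ᵥ withOne em fun q => γ (y u q) := by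
      funext u
      rw [heval₁ (U i) (G i) t (Sigma.mk i) (P i) (fun _ => rfl) X u]
    rw [hY, heval₂ (U i) (G i) t (P i) (fun u => withOne em fun q => γ (y u q))
      (fun u => by simp [withOne])]
  refine (pi_norm_le_iff_of_nonneg hε.le).2 fun v => (pi_norm_le_iff_of_nonneg hε.le).2 fun j => ?_
  rw [Pi.sub_apply, Pi.sub_apply, heval, Real.norm_eq_abs]
  set A := Φ i (fun v q => γ (y v q)) v j with hA
  have h1 : |∑ r, a₂ r * σ (w₂ r * A + b₂ r) - A| ≤ ε / 3 := hid₂ A (hΦM _ _ _ _)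
  have h2 : |A - Φ i y v j| ≤ ε / 3 := by
    rw [← Real.dist_eq]
    exact (dist_le_pi_dist (Φ i (fun v q => γ (y v q)) v) (Φ i y v) j).trans
      ((dist_le_pi_dist (Φ i (fun v q => γ (y v q))) (Φ i y) v).trans
        (hn i γ hid₁ y ⟨X, hX, rfl⟩))
  have h3 : |Φ i y v j - H i X v j| ≤ ε / 3 := by
    let ω : U i → PointedSignal U K := fun u => ⟨⟨i, u⟩, X, hX⟩
    have hH : H i X v j = ∑ u, κ i v u * τ j (ω u) := by
      have hdet := (Matrix.isUnit_iff_isUnit_det _).1 (isUnit_heat (G i) t)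
      have h4 : κ i *ᵥ ((κ i)⁻¹ *ᵥ fun w => H i X w j) = fun w => H i X w j := by
        rw [Matrix.mulVec_mulVec, Matrix.mul_nonsing_inv _ hdet, Matrix.one_mulVec]
      exact (congrFun h4 v).symm
    have hq : ∀ u, |M * (2 * s j (read i y u) / (1 + s j (read i y u) ^ 2)) - τ j (ω u)| ≤
        ε / 3 := by
      intro u
      have h5 : τ j (ω u) = M * (2 * halfSlope (τ j (ω u) / M) /
          (1 + halfSlope (τ j (ω u) / M) ^ 2)) := by
        rw [two_mul_halfSlope_div (hτM j (ω u))]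
        field_simp
      rw [h5, ← mul_sub, abs_mul, abs_of_pos hM]
      calc _ ≤ M * (2 * |s j (read i y u) - halfSlope (τ j (ω u) / M)|) :=
            mul_le_mul_of_nonneg_left (abs_two_mul_div_sub_le _ _) hM.le
        _ ≤ M * (2 * (ε / (6 * M))) := by
            gcongr
            exact hsτ j (ω u)
        _ = ε / 3 := by field_simp; norm_num
    rw [hH, ← Finset.sum_sub_distrib]
    calc _ ≤ ∑ u, κ i v u * (ε / 3) := by
          refine (Finset.abs_sum_le_sum_abs _ _).trans (Finset.sum_le_sum fun u _ => ?_)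
          rw [← mul_sub, abs_mul, abs_of_nonneg (hκ i v u)]
          exact mul_le_mul_of_nonneg_left (hq u) (hκ i v u)
      _ = ε / 3 := by rw [← Finset.sum_mul, heat_sum, one_mul]
  have h4 := abs_sub_le (∑ r, a₂ r * σ (w₂ r * A + b₂ r)) A (Φ i y v j)
  have h5 := abs_sub_le (∑ r, a₂ r * σ (w₂ r * A + b₂ r)) (Φ i y v j) (H i X v j)
  linarith

end Universality

end BundleNN

theorem mainTheorem1 (c c' : ℕ) :
    ∃ C : ℕ, ∀ (σ : ℝ → ℝ), Continuous σ →
      (¬ ∃ p : Polynomial ℝ, ∀ x, σ x = p.eval x) →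
      ∀ (t : ℝ), 0 < t →
      ∀ (ι : Type*) (V : ι → Type*) [∀ i, Fintype (V i)] [∀ i, DecidableEq (V i)]
        (G : ∀ i, SimpleGraph (V i)) [∀ i, DecidableRel (G i).Adj],
      (∀ i, (G i).Connected) →
      ∀ (f : ℕ) (P : ∀ i, V i → Fin f → ℝ), BundleNN.InjectiveEncoding P →
      ∀ H : BundleNN.FeatureTransformation V c c',
        BundleNN.CompactlyUniformlyApproximates
          (BundleNN.positionalBunnClass σ G t P c c') H ∧
        ((∃ z, DifferentiableAt ℝ σ z ∧ deriv σ z ≠ 0) →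
          ∀ (S : Finset ι) (K : Set (Fin c → ℝ)), IsCompact K → ∀ ε : ℝ, 0 < ε →
            ∃ d m : ℕ, d ≤ C * ∑ i ∈ S, Fintype.card (V i) ∧
              m ≤ C * ∑ i ∈ S, Fintype.card (V i) ∧
              ∃ F ∈ BundleNN.bunnClass σ G t P c c' d m, BundleNN.IsUniformlyClose F H S K ε) := by
  refine ⟨5 * c + 4 * c' + 2, ?_⟩
  intro σ hσ hpoly t ht ι V _ _ G _ hG f P hP H
  have hPS : ∀ S : Finset ι, BundleNN.InjectiveEncoding fun i : {i // i ∈ S} => P i.1 := by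
    rintro S ⟨⟨i, hi⟩, v⟩ ⟨⟨j, hj⟩, w⟩ h
    have h1 := hP (a₁ := ⟨i, v⟩) (a₂ := ⟨j, w⟩) h
    obtain ⟨rfl, h2⟩ := Sigma.mk.inj_iff.1 h1
    rw [eq_of_heq h2]
  refine ⟨fun S K hK ε hε => ?_, fun hderiv S K hK ε hε => ?_⟩
  · obtain ⟨d, m, B, hB, h⟩ := BundleNN.exists_positional_approx
      (fun i : {i // i ∈ S} => G i.1) hσ hpoly ht (fun i => hG i.1) (fun i => P i.1) (hPS S)
      (fun i => H i.1) hK hε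
    refine ⟨fun i => ⟨fun X => B.eval σ (G i) t (P i) X, ?_⟩, ⟨d, m, B, hB, fun _ _ => rfl⟩,
      fun i hi X hX => h ⟨i, hi⟩ X hX⟩
    exact BundleNN.continuous_bunn_eval (G i) σ t (P i) B hσ
      (BundleNN.continuous_bundleMap_of_isPositional _ σ hB.1)
      (BundleNN.continuous_bundleMap_of_isPositional _ σ hB.2)
  · rcases S.eq_empty_or_nonempty with rfl | ⟨i₀, hi₀⟩
    · -- For the empty subfamily the bound leaves width zero only.
      refine ⟨0, 0, by simp, by simp, 0, ?_, by simp [BundleNN.IsUniformlyClose]⟩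
      let L : BundleNN.Layer f 0 := ⟨⟨0, 0, 0, 0, 0⟩, 0, 0⟩
      refine ⟨⟨0, L, 0, 0, L, 0⟩, fun i X => ?_⟩
      ext v j
      simp [BundleNN.BuNN₂.eval]
    · have : Nonempty (Σ i : {i // i ∈ S}, V i.1) := by
        obtain ⟨v⟩ := (hG i₀).nonempty
        exact ⟨⟨⟨i₀, hi₀⟩, v⟩⟩
      obtain ⟨d, m, hd, hm, B, hB₁, hB₂, h⟩ := BundleNN.exists_narrow_approx
        (fun i : {i // i ∈ S} => G i.1) hσ hpoly hderiv ht (fun i => hG i.1) (fun i => P i.1)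
        (hPS S) (fun i => H i.1) hK hε
      rw [Finset.sum_coe_sort S fun i => Fintype.card (V i)] at hd hm
      exact ⟨d, m, hd, hm, fun i => ⟨fun X => B.eval σ (G i) t (P i) X,
        BundleNN.continuous_bunn_eval (G i) σ t (P i) B hσ hB₁ hB₂⟩, ⟨B, fun _ _ => rfl⟩,
        fun i hi X hX => h ⟨i, hi⟩ X hX⟩
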